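/- Consider a stable FIFO single-server $GI/GI/1/\infty$ queue: $(\sigma_n)_{n\in\mathbb Z}$ (service times) and $(\tau_n)_{n\in\mathbb Z}$ (interarrival times, $\tau_n$ being the time between the arrivals of customers $n$ and $n+1$) are two independent sequences of i.i.d. nonnegative random variables with finite means $b=\mathbf E\sigma_0<a=\mathbf E\tau_0$. Let $F$ be the distribution function of $\sigma_0$, $\overline F=1-F$, and let $F^s$ be its integrated tail distribution on $[0,\infty)$, $\overline{F^s}(x)=1-F^s(x)=\min\{1,\int_x^\infty\overline F(u)\,du\}$ for $x\ge 0$. Assume that $F^s$ is subexponential, i.e. $\overline{F^s}(x)>0$ for all $x$, and $\mathbf P(\zeta_1+\zeta_2>x)\sim 2\overline{F^s}(x)$ as $x\to\infty$ for independent $\zeta_1,\zeta_2$ with distribution $F^s$. Here $f(x)\sim c\,g(x)$, for $c>0$, means $f(x)/g(x)\to c$ as $x\to\infty$. Let $x\mapsto N_x$ be a nondecreasing function with values in the nonnegative integers such that $N_x\to\infty$ as $x\to\infty$ and, for every real $c$, $\sum_{n=0}^{N_x}\overline F(x+nc)=o(\overline{F^s}(x))$ as $x\to\infty$. For each $x$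 let $(K_{n,x})_{n\ge 0}$ be a sequence of events such that (i) for every $n$ and $x$, the event $K_{n,x}$ and the random variable $\sigma_{-n}$ are independent; (ii) $\mathbf P(K_{n,x})\to 1$ as $x\to\infty$, uniformly in $n\ge N_x$. For any real sequence $\eta_n\to 0$, put $$A_{n,x}=K_{n,x}\cap\{\sigma_{-n}>x+n(a-b+\eta_n)\},\qquad A_x=\bigcup_{n\ge N_x}A_{n,x}.$$ Let $W$ be the stationary waiting time of customer $0$ (the limit as $k\to\infty$ of its waiting time when the queue starts empty at the arrival of customer $-k$) and $R=W+\sigma_0$ its stationary response time. Then, as $x\to\infty$, $$\mathbf P(W>x)\sim\mathbf P(W>x,A_x)\sim\mathbf P(A_x)\sim\sum_{n\ge N_x}\mathbf P(W>x,A_{n,x})\sim\sum_{n\ge N_x}\mathbf P(A_{n,x}),$$ and $$\mathbf P(R>x)\sim\mathbf P(W>x).$$ -/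

import Mathlib

open MeasureTheory ProbabilityTheory Set Filter Topology

/-- Asymptotic equivalence `f(x) ∼ g(x)` as `x → ∞`: the quotient tends to `1`. Since division by
zero gives `0`, this forces both functions to be nonzero for all large `x`. -/
def TailEquiv (f g : ℝ → ℝ) : Prop :=
  Tendsto (fun x => f x / g x) atTop (𝓝 1)

/-- The law `μ` on `ℝ` is subexponential: it is a probability law on `[0, ∞)` with positive tail
everywhere and `P(ξ₁ + ξ₂ > x) ∼ 2 P(ξ₁ > x)` for independent `ξ₁, ξ₂` of law `μ`. -/
def IsSubexponential (μ : Measure ℝ) : Prop :=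
  IsProbabilityMeasure μ ∧ μ (Iio 0) = 0 ∧ (∀ x : ℝ, 0 < μ (Ioi x)) ∧
    Tendsto (fun x : ℝ => (μ.prod μ).real {p : ℝ × ℝ | x < p.1 + p.2} / μ.real (Ioi x))
      atTop (𝓝 2)

lemma tendsto_lintegral_Ioi_right (f : ℝ → ENNReal) (x : ℝ) :
    Tendsto (fun y => ∫⁻ u in Ioi y, f u) (𝓝[≥] x) (𝓝 (∫⁻ u in Ioi x, f u)) := by
  have hanti : Antitone (fun y => ∫⁻ u in Ioi y, f u) := fun y z h =>
    lintegral_mono_set (Ioi_subset_Ioi h)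
  refine tendsto_order.2 ⟨fun c hc => ?_, fun c hc => ?_⟩
  · obtain ⟨u, hu, hux, hlim⟩ := exists_seq_strictAnti_tendsto x
    have hun : Ioi x = ⋃ n, Ioi (u n) := by
      ext y
      simp only [mem_iUnion, mem_Ioi]
      constructor
      · intro hy
        exact (hlim.eventually (gt_mem_nhds hy)).exists
      · rintro ⟨n, hn⟩
        exact (hux n).trans hn
    rw [hun, setLIntegral_iUnion_of_directed f (directed_of_isDirected_le
      fun m n h => Ioi_subset_Ioi (hu.antitone h)), lt_iSup_iff] at hc
    obtain ⟨n, hn⟩ := hc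
    filter_upwards [mem_nhdsWithin_of_mem_nhds (gt_mem_nhds (hux n))] with y hy
    exact hn.trans_le (hanti (le_of_lt hy))
  · filter_upwards [self_mem_nhdsWithin] with y hy
    exact (hanti hy).trans_lt hc

/-- The distribution function `F^s(x) = 1 - min {1, ∫_x^∞ (1 - F(u)) du}`, `x ≥ 0`, of the
integrated tail distribution of the law `μ` with distribution function `F`; it is a distribution
function on `[0, ∞)`, so it vanishes for `x < 0`. -/
noncomputable def integratedTailCdf (μ : Measure ℝ) : StieltjesFunction ℝ where
  toFun x := if x < 0 then 0 else 1 - (min 1 (∫⁻ u in Ioi x, μ (Ioi u))).toReal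
  mono' := by
    have hle : ∀ x : ℝ, (min 1 (∫⁻ u in Ioi x, μ (Ioi u))).toReal ≤ 1 := fun x =>
      ENNReal.toReal_le_of_le_ofReal zero_le_one (by simp)
    intro x y hxy
    simp only
    split_ifs with h1 h2 h2
    · exact le_rfl
    · linarith [hle y]
    · exact absurd (hxy.trans_lt h2) h1
    · refine sub_le_sub_left (ENNReal.toReal_mono (by simp) (min_le_min le_rfl ?_)) 1
      exact lintegral_mono_set (Ioi_subset_Ioi hxy)
  right_continuous' := by
    intro x
    rcases lt_or_ge x 0 with hx | hx
    · refine ContinuousAt.continuousWithinAt ?_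
      refine (continuousAt_const (y := (0 : ℝ))).congr ?_
      filter_upwards [gt_mem_nhds hx] with y hy
      simp [hy]
    · have h : Tendsto (fun y => 1 - (min 1 (∫⁻ u in Ioi y, μ (Ioi u))).toReal) (𝓝[≥] x)
          (𝓝 (1 - (min 1 (∫⁻ u in Ioi x, μ (Ioi u))).toReal)) :=
        tendsto_const_nhds.sub ((ENNReal.tendsto_toReal (by simp)).comp
          (tendsto_const_nhds.min (tendsto_lintegral_Ioi_right _ x)))
      have hx' : ¬ x < 0 := not_lt.2 hx
      unfold ContinuousWithinAt
      simp only [hx', if_false]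
      refine h.congr' ?_
      filter_upwards [self_mem_nhdsWithin] with y hy
      simp [not_lt.2 (hx.trans hy)]

/-- The integrated tail distribution of `μ`, as a law on `ℝ`. -/
noncomputable def integratedTail (μ : Measure ℝ) : Measure ℝ :=
  (integratedTailCdf μ).measure

/-- Single-server FIFO queue: `s n` is the service time of customer `n` and `t n` the time between
the arrivals of customers `n` and `n + 1`. `waitFrom s t m k` is the waiting time of customer
`m + k` when customer `m` finds the system empty (Lindley recursion). -/
noncomputable def waitFrom (s t : ℤ → ℝ) (m : ℤ) : ℕ → ℝ
  | 0 => 0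
  | k + 1 => max 0 (waitFrom s t m k + s (m + k) - t (m + k))

lemma waitFrom_nonneg (s t : ℤ → ℝ) (m : ℤ) (k : ℕ) : 0 ≤ waitFrom s t m k := by
  cases k with
  | zero => exact le_rfl
  | succ k => exact le_max_left _ _

lemma waitFrom_le (s t : ℤ → ℝ) (m : ℤ) (k : ℕ) :
    waitFrom s t m k ≤ waitFrom s t (m - 1) (k + 1) := by
  induction k with
  | zero => exact waitFrom_nonneg _ _ _ _
  | succ k ih =>
    rw [waitFrom, waitFrom]
    have h : m - 1 + ((k + 1 : ℕ) : ℤ) = m + k := by push_cast; ring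
    rw [h]
    gcongr

/-- The stationary waiting time of customer `0`: the limit, as `k → ∞`, of its waiting time when
the queue starts empty at the arrival of customer `-k`. The limit is monotone, hence a supremum;
it is taken in the extended reals, so no boundedness is presupposed. -/
noncomputable def stationaryWait (s t : ℤ → ℝ) : EReal :=
  ⨆ k : ℕ, (waitFrom s t (-k) k : EReal)

lemma tendsto_stationaryWait (s t : ℤ → ℝ) :
    Tendsto (fun k : ℕ => (waitFrom s t (-k) k : EReal)) atTop (𝓝 (stationaryWait s t)) := by
  refine tendsto_atTop_iSup (monotone_nat_of_le_succ fun k => EReal.coe_le_coe_iff.2 ?_)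
  have h := waitFrom_le s t (-k) k
  rwa [show (-(k : ℤ) - 1) = -((k + 1 : ℕ) : ℤ) by push_cast; ring] at h

/-- The stationary response time of customer `0`: waiting time plus own service time. -/
noncomputable def stationaryResponse (s t : ℤ → ℝ) : EReal :=
  stationaryWait s t + (s 0 : EReal)

/-- The event `A_{n,x} = K_{n,x} ∩ {σ_{-n} > x + n (a - b + η_n)}`. -/
def typicalEvent {Ω : Type*} (σ : ℤ → Ω → ℝ) (a b : ℝ) (η : ℕ → ℝ) (K : ℕ → ℝ → Set Ω)
    (n : ℕ) (x : ℝ) : Set Ω :=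
  K n x ∩ {ω | x + n * (a - b + η n) < σ (-n) ω}

/-! Write m = a - b and J(x) for the integral of the service tail over (x, ∞), which equals the tail
of F^s for large x. Each probability and sum in the statement is asymptotic to J(x)/m, so it
suffices to bound the largest of them from above and the smallest from below.

The waiting time is the maximum of the random walk with increments σ_{-n} - τ_{-n}, n ≥ 1, of drift
-m, and almost surely each increment is at most the service time. The upper bound on P(W > x) is one
half of Veraverbeke's theorem (`eventually_measure_exists_lt_sum_le`). Stop the walk when it first
exceeds the line A - nd, with d < m. This happens with small probability γ if A is large; the
overshoot needs one big increment, so the tail of the stopped position is at most about J/d.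
Restarting the walk there gives a defective renewal inequality, and subexponentiality bounds its
solution by about J/(d(1 - γ)) (`IsSubexponential.eventually_tail_le`). Then let d → m and γ → 0.
The sum of the P(A_{n,x}) has the same bound because A_{n,x} lies in {σ_{-n} > x + n(m - ε)}, whose
probabilities form a Riemann sum for J/(m - ε).

The lower bound, on P(W > x, A_x), is the single big jump. By the law of large numbers, the rest of
the walk up to time n typically stays above -n(m + ε), so σ_{-n} > x + n(m + ε) forces W > x. These
events are nearly exclusive: the pair terms in Bonferroni's inequality total O(J²), and the terms
with n ≤ N_x are negligible by the choice of N_x (`eventually_le_measureReal_iUnion`).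

For the response time, R ≥ W almost surely, while the next customer waits at least R - τ_0 with τ_0
independent of R (`measure_response_mul_le`); since J is long-tailed, a bounded shift of x costs
nothing. -/

/-! ### Defective renewal inequalities with subexponential tails -/

/-- A renewal-type inequality with defect `γ < 1` bounds the ratio of a tail `m` to a long tail
`g` by `c / (1 - γ)`. -/
lemma eventually_le_of_defective_renewal {m g h : ℝ → ℝ} {γ c : ℝ} (hγ0 : 0 ≤ γ) (hγ : γ < 1)
    (hg : ∀ x, 0 < g x) (hganti : Antitone g) (hm0 : ∀ x, 0 ≤ m x)
    (hm1 : ∀ x, m x ≤ 1)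
    (hlong : ∀ B, Tendsto (fun x => g (x - B) / g x) atTop (𝓝 1))
    (hh : ∀ c' > c, ∀ᶠ x in atTop, h x ≤ c' * g x)
    (hrec : ∀ δ > 0, ∃ B ≥ 0, ∀ᶠ x in atTop, ∀ κ ≥ 0, (∀ u ≤ x, m u ≤ κ * g u) →
      m x ≤ γ * m (x - B) + h (x - B) + κ * δ * g x) :
    ∀ c' > c / (1 - γ), ∀ᶠ x in atTop, m x ≤ c' * g x := by
  have hshift : ∀ (B : ℝ) {p q : ℝ}, p < q → ∀ᶠ x in atTop, p * g (x - B) ≤ q * g x := by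
    intro B p q hpq
    have h1 := (hlong B).const_mul p
    rw [mul_one] at h1
    filter_upwards [h1.eventually (gt_mem_nhds hpq)] with x hx
    rw [← mul_div_assoc, div_lt_iff₀ (hg x)] at hx
    exact hx.le
  have hback : ∀ (B : ℝ) {p : ℝ → Prop}, (∀ᶠ x in atTop, p x) → ∀ᶠ x in atTop, p (x - B) :=
    fun B p hp => (tendsto_atTop_add_const_right atTop (-B) tendsto_id).eventually hp
  -- A priori bound. The supremum s of m/g over (-∞, x] is finite because m ≤ 1 and g is antitone.
  -- With δ = (1 - γ)/4 the recursion gives s ≤ max (1/g(X)) (s(1 + γ)/2 + c + 2), hence a bound on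
  -- s that does not depend on x.
  obtain ⟨κ, hκ0, hκ⟩ : ∃ κ ≥ 0, ∀ x, m x ≤ κ * g x := by
    obtain ⟨B, hB0, hB⟩ := hrec ((1 - γ) / 4) (by linarith)
    have hev := (hB.and (hshift B (p := γ) (q := γ + (1 - γ) / 4) (by linarith))).and
      ((hshift B (p := c + 1) (q := c + 2) (by linarith)).and
        (hback B (hh (c + 1) (by linarith))))
    obtain ⟨X, hX⟩ := eventually_atTop.1 hev
    set κ := max (1 / g X) ((c + 2) / ((1 - γ) / 2)) with hκdef
    have hκ0 : 0 ≤ κ := le_max_of_le_left (by have := hg X; positivity)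
    refine ⟨κ, hκ0, fun x => ?_⟩
    let S := (fun u => m u / g u) '' Iic x
    have hbdd : BddAbove S := by
      refine ⟨1 / g x, ?_⟩
      rintro _ ⟨u, hu, rfl⟩
      exact div_le_div₀ zero_le_one (hm1 u) (hg x) (hganti hu)
    have hmem : ∀ u ≤ x, m u / g u ≤ sSup S := fun u hu => le_csSup hbdd ⟨u, hu, rfl⟩
    have hs0 : 0 ≤ sSup S := (div_nonneg (hm0 x) (hg x).le).trans (hmem x le_rfl)
    have hle : sSup S ≤ κ := by
      have hb : ∀ u ≤ x, m u / g u ≤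
          max (1 / g X) (sSup S * ((1 + γ) / 2) + (c + 2)) := by
        intro u hu
        rcases le_total u X with huX | huX
        · exact le_max_of_le_left (div_le_div₀ zero_le_one (hm1 u) (hg X) (hganti huX))
        · refine le_max_of_le_right ?_
          obtain ⟨⟨h1, h2⟩, h3, h4⟩ := hX u huX
          have h5 : ∀ v ≤ u, m v ≤ sSup S * g v := fun v hv =>
            (div_le_iff₀ (hg v)).1 (hmem v (hv.trans hu))
          rw [div_le_iff₀ (hg u)]
          have h6 := h1 _ hs0 h5
          have h7 := mul_le_mul_of_nonneg_left (h5 (u - B) (by linarith)) hγ0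
          have h8 := mul_le_mul_of_nonneg_left h2 hs0
          nlinarith
      have h9 : sSup S ≤ max (1 / g X) (sSup S * ((1 + γ) / 2) + (c + 2)) := by
        refine csSup_le ⟨_, x, mem_Iic.2 le_rfl, rfl⟩ ?_
        rintro _ ⟨u, hu, rfl⟩
        exact hb u hu
      rcases le_max_iff.1 h9 with h | h
      · exact le_max_of_le_left h
      · refine le_max_of_le_right ?_
        rw [le_div_iff₀ (by linarith)]
        linarith
    exact (div_le_iff₀ (hg x)).1 ((hmem x le_rfl).trans hle)
  -- One pass through the recursion improves an eventual bound ℓ to nearly γℓ + c; the fixed point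
  -- of this map is c / (1 - γ).
  have hstep : ∀ ℓ, (∀ᶠ x in atTop, m x ≤ ℓ * g x) → ∀ δ > 0,
      ∀ᶠ x in atTop, m x ≤ (γ * ℓ + c + δ) * g x := by
    intro ℓ hℓ δ hδ
    obtain ⟨B, hB0, hB⟩ := hrec (δ / 3 / (κ + 1)) (by positivity)
    filter_upwards [hB, hback B hℓ, hback B (hh (c + δ / 3) (by linarith)),
      hshift B (p := γ * ℓ + c + δ / 3) (q := γ * ℓ + c + 2 * (δ / 3)) (by linarith)]
      with x h1 h2 h3 h4
    have h5 := h1 κ hκ0 fun u _ => hκ u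
    have h6 : κ * (δ / 3 / (κ + 1)) ≤ δ / 3 := by
      rw [mul_div_assoc', div_le_iff₀ (by linarith)]
      nlinarith
    have h7 := mul_le_mul_of_nonneg_right h6 (hg x).le
    have h8 := mul_le_mul_of_nonneg_left h2 hγ0
    nlinarith
  intro c' hc'
  -- The infimum of the eventual bounds is at most its own image under ℓ ↦ γℓ + c, so it cannot stay
  -- above c' > c / (1 - γ).
  by_contra hcon
  let S := {ℓ | ∀ᶠ x in atTop, m x ≤ ℓ * g x}
  have hne : S.Nonempty := ⟨κ, Eventually.of_forall hκ⟩
  have hlow : ∀ ℓ ∈ S, c' ≤ ℓ := by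
    intro ℓ hℓ
    by_contra! hlt
    refine hcon ?_
    filter_upwards [hℓ] with x hx
    exact hx.trans (mul_le_mul_of_nonneg_right hlt.le (hg x).le)
  have hbb : BddBelow S := ⟨c', hlow⟩
  have hinf : c' ≤ sInf S := le_csInf hne hlow
  rw [gt_iff_lt, div_lt_iff₀ (by linarith)] at hc'
  set δ := (c' * (1 - γ) - c) / 3 with hδ
  have hδ0 : 0 < δ := by rw [hδ]; linarith
  obtain ⟨ℓ, hℓ, hℓlt⟩ := exists_lt_of_csInf_lt hne (lt_add_of_pos_right (sInf S) hδ0)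
  have h1 : sInf S ≤ γ * ℓ + c + δ := csInf_le hbb (hstep ℓ hℓ δ hδ0)
  nlinarith

lemma tendsto_measureReal_Ioi_atTop (μ : Measure ℝ) [IsFiniteMeasure μ] :
    Tendsto (fun x => μ.real (Ioi x)) atTop (𝓝 0) := by
  have h1 : Tendsto (fun x => μ (Ioi x)) atTop (𝓝 (μ (⋂ x : ℝ, Ioi x))) :=
    tendsto_measure_iInter_atTop (fun _ => measurableSet_Ioi.nullMeasurableSet)
      (fun x y h => Ioi_subset_Ioi h) ⟨0, measure_ne_top _ _⟩
  have h2 : (⋂ x : ℝ, Ioi x) = ∅ := by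
    ext y
    simp only [mem_iInter, mem_Ioi, mem_empty_iff_false, iff_false]
    exact fun h => lt_irrefl y (h y)
  rw [h2, measure_empty] at h1
  exact (ENNReal.tendsto_toReal ENNReal.zero_ne_top).comp h1

/-- Two large summands are an unlikely way to obtain a large sum. Of the total mass, about 2 G(x,
∞), the two rectangles with one coordinate in [0, B] and the other beyond x already take at least 2
(1 - G(B, ∞)) G(x, ∞). -/
lemma IsSubexponential.eventually_prod_both_large_le {G : Measure ℝ} (hG : IsSubexponential G)
    {B δ : ℝ} (hδ : 0 < δ) :
    ∀ᶠ x in atTop, (G.prod G).real {p : ℝ × ℝ | B < p.1 ∧ B < p.2 ∧ x < p.1 + p.2} ≤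
      (2 * G.real (Ioi B) + δ) * G.real (Ioi x) := by
  obtain ⟨hprob, hneg, hpos, hlim⟩ := hG
  filter_upwards [hlim.eventually (gt_mem_nhds (show (2 : ℝ) < 2 + δ by linarith)),
    eventually_ge_atTop B] with x hx hxB
  have hgx : 0 < G.real (Ioi x) := by
    rw [measureReal_def]; exact ENNReal.toReal_pos (hpos x).ne' (measure_ne_top _ _)
  rw [div_lt_iff₀ hgx] at hx
  have hm1 : MeasurableSet {p : ℝ × ℝ | B < p.1 ∧ B < p.2 ∧ x < p.1 + p.2} :=
    ((measurableSet_lt measurable_const measurable_fst).inter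
      ((measurableSet_lt measurable_const measurable_snd).inter
        (measurableSet_lt measurable_const (measurable_fst.add measurable_snd))))
  have hIcc : 1 - G.real (Ioi B) ≤ G.real (Icc 0 B) := by
    have h1 : (univ : Set ℝ) ⊆ Iio 0 ∪ (Icc 0 B ∪ Ioi B) := by
      intro y _
      by_cases h0 : y < 0
      · exact Or.inl h0
      · by_cases h2 : y ≤ B
        · exact Or.inr (Or.inl ⟨not_lt.1 h0, h2⟩)
        · exact Or.inr (Or.inr (not_le.1 h2))
    have h2 := measureReal_mono (μ := G) h1
    have h3 := measureReal_union_le (μ := G) (Iio 0) (Icc 0 B ∪ Ioi B)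
    have h4 := measureReal_union_le (μ := G) (Icc 0 B) (Ioi B)
    have h5 : G.real (Iio 0) = 0 := by simp [measureReal_def, hneg]
    rw [probReal_univ] at h2
    linarith
  have hsub : {p : ℝ × ℝ | B < p.1 ∧ B < p.2 ∧ x < p.1 + p.2} ∪
      (Icc 0 B ×ˢ Ioi x ∪ Ioi x ×ˢ Icc 0 B) ⊆ {p : ℝ × ℝ | x < p.1 + p.2} := by
    rintro ⟨y, z⟩ (⟨_, _, h⟩ | ⟨⟨h0, _⟩, h1⟩ | ⟨h1, ⟨h0, _⟩⟩)
    · exact h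
    · simp only [mem_Ioi] at h1 ⊢; simp only [mem_ofPred_eq] at *; linarith
    · simp only [mem_Ioi] at h1 ⊢; simp only [mem_ofPred_eq] at *; linarith
  have hle := measureReal_mono (μ := G.prod G) hsub
  rw [measureReal_union _ ((measurableSet_Icc.prod measurableSet_Ioi).union
      (measurableSet_Ioi.prod measurableSet_Icc)),
    measureReal_union _ (measurableSet_Ioi.prod measurableSet_Icc), measureReal_prod_prod,
    measureReal_prod_prod] at hle
  · have := mul_le_mul_of_nonneg_right hIcc hgx.le
    nlinarith
  · rw [Set.disjoint_left]
    rintro ⟨y, z⟩ ⟨⟨_, h0⟩, _⟩ ⟨h1, _⟩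
    simp only [mem_Ioi] at *; linarith
  · rw [Set.disjoint_left]
    rintro ⟨y, z⟩ ⟨h1, h2, _⟩ (⟨⟨_, h0⟩, _⟩ | ⟨_, ⟨_, h0⟩⟩)
    · simp only at *; linarith
    · simp only at *; linarith

/-- The integral is a mass under H × G. For each fixed second coordinate z the section in the first
is contained in a half-line, so H can be exchanged for C G; the restriction y ≤ x - B forces z > B.
-/
lemma setLIntegral_tail_sub_le (G H : Measure ℝ) [IsFiniteMeasure G] [IsFiniteMeasure H]
    {C : ENNReal} (hC : ∀ y, H (Ioi y) ≤ C * G (Ioi y)) (B x : ℝ) :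
    ∫⁻ y in Ioc B (x - B), G (Ioi (x - y)) ∂H ≤
      C * (G.prod G) {p : ℝ × ℝ | B < p.1 ∧ B < p.2 ∧ x < p.1 + p.2} := by
  have hm : MeasurableSet {p : ℝ × ℝ | x < p.1 + p.2} :=
    measurableSet_lt measurable_const (measurable_fst.add measurable_snd)
  have hm1 : MeasurableSet {p : ℝ × ℝ | B < p.1 ∧ B < p.2 ∧ x < p.1 + p.2} :=
    ((measurableSet_lt measurable_const measurable_fst).inter
      ((measurableSet_lt measurable_const measurable_snd).inter hm))
  have h1 : ∫⁻ y in Ioc B (x - B), G (Ioi (x - y)) ∂H =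
      ((H.restrict (Ioc B (x - B))).prod G) {p : ℝ × ℝ | x < p.1 + p.2} := by
    rw [Measure.prod_apply hm]
    refine lintegral_congr fun y => congrArg G ?_
    ext z
    simp only [mem_Ioi, mem_preimage, mem_ofPred_eq, sub_lt_iff_lt_add']
  rw [h1, Measure.prod_apply_symm hm, Measure.prod_apply_symm hm1,
    ← lintegral_const_mul _ (measurable_measure_prodMk_right hm1)]
  refine lintegral_mono fun z => ?_
  rw [Measure.restrict_apply (hm.preimage measurable_prodMk_right)]
  by_cases hz : B < z
  · have h2 : (fun y => (y, z)) ⁻¹' {p : ℝ × ℝ | B < p.1 ∧ B < p.2 ∧ x < p.1 + p.2} =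
        Ioi (max B (x - z)) := by
      ext y
      simp only [mem_preimage, mem_ofPred_eq, mem_Ioi, max_lt_iff, hz, true_and,
        sub_lt_iff_lt_add]
    rw [h2]
    refine le_trans (measure_mono ?_) (hC _)
    rintro y ⟨hy1, hy2⟩
    simp only [mem_preimage, mem_ofPred_eq] at hy1
    exact max_lt hy2.1 (by linarith)
  · have h2 : (fun y => (y, z)) ⁻¹' {p : ℝ × ℝ | x < p.1 + p.2} ∩ Ioc B (x - B) = ∅ := by
      ext y
      simp only [mem_inter_iff, mem_preimage, mem_ofPred_eq, mem_Ioc, mem_empty_iff_false,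
        iff_false]
      rintro ⟨h3, _, h4⟩
      linarith
    rw [h2]
    simp

/-- Split the integral by y: monotonicity of m for y ≤ B, the bound m ≤ 1 for y > x - B, and the a
priori bound κ in between. H may charge negative y, which the first case also covers. -/
lemma le_of_le_lintegral_sub (G H : Measure ℝ) [IsFiniteMeasure G] [IsFiniteMeasure H]
    {C κ : ENNReal} (hC : ∀ y, H (Ioi y) ≤ C * G (Ioi y)) {m : ℝ → ENNReal} (hm : Antitone m)
    (hm1 : ∀ x, m x ≤ 1) {B x : ℝ} (hB : 0 ≤ B) (hx : m x ≤ ∫⁻ y, m (x - y) ∂H)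
    (hκ : ∀ u ≤ x, m u ≤ κ * G (Ioi u)) :
    m x ≤ H univ * m (x - B) + H (Ioi (x - B)) +
      κ * (C * (G.prod G) {p : ℝ × ℝ | B < p.1 ∧ B < p.2 ∧ x < p.1 + p.2}) := by
  have hGm : Measurable fun y => G (Ioi (x - y)) :=
    (Antitone.measurable fun y z h => measure_mono (Ioi_subset_Ioi h) :
      Measurable fun y => G (Ioi y)).comp (measurable_const.sub measurable_id)
  have hpt : ∀ y, m (x - y) ≤ (m (x - B) + (Ioi (x - B)).indicator (fun _ => 1) y) +
      (Ioc B (x - B)).indicator (fun y => κ * G (Ioi (x - y))) y := by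
    intro y
    by_cases h1 : y ≤ B
    · exact (hm (by linarith)).trans (le_add_right (le_add_right le_rfl))
    · by_cases h2 : x - B < y
      · refine le_add_right (le_add_left ?_)
        rw [indicator_of_mem (show y ∈ Ioi (x - B) from h2)]
        exact hm1 _
      · refine le_add_left ?_
        rw [indicator_of_mem (show y ∈ Ioc B (x - B) from ⟨not_le.1 h1, not_lt.1 h2⟩)]
        exact hκ _ (by linarith)
  refine hx.trans ((lintegral_mono hpt).trans ?_)
  rw [lintegral_add_right _ ((hGm.const_mul κ).indicator measurableSet_Ioc),
    lintegral_add_left measurable_const, lintegral_const, lintegral_indicator measurableSet_Ioi,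
    lintegral_indicator measurableSet_Ioc, lintegral_const_mul _ hGm, setLIntegral_one, mul_comm]
  gcongr
  exact setLIntegral_tail_sub_le G H hC B x

/-- Upper tail bound for a subexponential defective renewal inequality. -/
lemma IsSubexponential.eventually_tail_le {G : Measure ℝ} (hG : IsSubexponential G)
    (hlong : ∀ B, Tendsto (fun x => G.real (Ioi (x - B)) / G.real (Ioi x)) atTop (𝓝 1))
    (H : Measure ℝ) [IsFiniteMeasure H] {c A : ℝ} (hc : 0 ≤ c) (hH1 : H.real univ < 1)
    (hH : ∀ c' > c, ∀ᶠ x in atTop, H.real (Ioi x) ≤ c' * G.real (Ioi x))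
    {m : ℝ → ENNReal} (hm : Antitone m) (hm1 : ∀ x, m x ≤ 1)
    (hrec : ∀ x ≥ A, m x ≤ ∫⁻ y, m (x - y) ∂H) :
    ∀ c' > c / (1 - H.real univ), ∀ᶠ x in atTop, (m x).toReal ≤ c' * G.real (Ioi x) := by
  have hprob := hG.1
  have hg : ∀ x, 0 < G.real (Ioi x) := fun x => by
    rw [measureReal_def]; exact ENNReal.toReal_pos (hG.2.2.1 x).ne' (measure_ne_top _ _)
  have hganti : Antitone fun x => G.real (Ioi x) := fun x y h =>
    measureReal_mono (Ioi_subset_Ioi h)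
  have hmtop : ∀ x, m x ≠ ⊤ := fun x => ((hm1 x).trans_lt ENNReal.one_lt_top).ne
  have hgtend := tendsto_measureReal_Ioi_atTop G
  obtain ⟨C, hC0, hC⟩ : ∃ C ≥ 0, ∀ y, H.real (Ioi y) ≤ C * G.real (Ioi y) := by
    obtain ⟨X, hX⟩ := eventually_atTop.1 (hH (c + 1) (by linarith))
    refine ⟨max (c + 1) (H.real univ / G.real (Ioi X)), le_max_of_le_left (by linarith),
      fun y => ?_⟩
    rcases le_total X y with h | h
    · exact (hX y h).trans (mul_le_mul_of_nonneg_right (le_max_left _ _) (hg y).le)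
    · calc H.real (Ioi y) ≤ H.real univ := measureReal_mono (subset_univ _)
        _ = H.real univ / G.real (Ioi X) * G.real (Ioi X) := (div_mul_cancel₀ _ (hg X).ne').symm
        _ ≤ _ := mul_le_mul (le_max_right _ _) (hganti h) (hg X).le
          (le_max_of_le_left (by linarith))
  have hC' : ∀ y, H (Ioi y) ≤ ENNReal.ofReal C * G (Ioi y) := fun y => by
    have := ENNReal.ofReal_le_ofReal (hC y)
    rwa [ENNReal.ofReal_mul hC0, ofReal_measureReal, ofReal_measureReal] at this
  refine eventually_le_of_defective_renewal (m := fun x => (m x).toReal)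
    (h := fun x => H.real (Ioi x)) measureReal_nonneg hH1 hg hganti
    (fun x => ENNReal.toReal_nonneg)
    (fun x => ENNReal.toReal_le_of_le_ofReal zero_le_one (by simpa using hm1 x)) hlong hH ?_
  intro δ hδ
  -- Used both as a bound for G(B, ∞) and as the slack of the two-large-summands estimate: C times
  -- three such quantities stays below δ.
  have h4 : (0 : ℝ) < δ / (4 * (C + 1)) := by positivity
  obtain ⟨B, hBsmall, hB0⟩ := ((hgtend.eventually (gt_mem_nhds h4)).and
    (eventually_ge_atTop 0)).exists
  refine ⟨B, hB0, ?_⟩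
  filter_upwards [hG.eventually_prod_both_large_le (B := B) h4, eventually_ge_atTop A]
    with x hx hxA κ hκ hκx
  have h5 := le_of_le_lintegral_sub G H hC' hm hm1 (κ := ENNReal.ofReal κ) hB0 (hrec x hxA)
    (fun u hu => by
      have := ENNReal.ofReal_le_ofReal (hκx u hu)
      rwa [ENNReal.ofReal_mul hκ, ofReal_measureReal, ENNReal.ofReal_toReal (hmtop u)] at this)
  have h6 := ENNReal.toReal_mono (by
    refine ENNReal.add_ne_top.2 ⟨ENNReal.add_ne_top.2 ⟨?_, measure_ne_top _ _⟩, ?_⟩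
    · exact ENNReal.mul_ne_top (measure_ne_top _ _) (hmtop _)
    · exact ENNReal.mul_ne_top ENNReal.ofReal_ne_top
        (ENNReal.mul_ne_top ENNReal.ofReal_ne_top (measure_ne_top _ _))) h5
  rw [ENNReal.toReal_add (ENNReal.add_ne_top.2 ⟨ENNReal.mul_ne_top (measure_ne_top _ _)
      (hmtop _), measure_ne_top _ _⟩) (ENNReal.mul_ne_top ENNReal.ofReal_ne_top
        (ENNReal.mul_ne_top ENNReal.ofReal_ne_top (measure_ne_top _ _))),
    ENNReal.toReal_add (ENNReal.mul_ne_top (measure_ne_top _ _) (hmtop _)) (measure_ne_top _ _),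
    ENNReal.toReal_mul, ENNReal.toReal_mul, ENNReal.toReal_mul, ENNReal.toReal_ofReal hκ,
    ENNReal.toReal_ofReal hC0] at h6
  refine h6.trans (add_le_add le_rfl ?_)
  rw [mul_assoc]
  refine mul_le_mul_of_nonneg_left ?_ hκ
  refine (mul_le_mul_of_nonneg_left hx hC0).trans ?_
  rw [← mul_assoc]
  refine mul_le_mul_of_nonneg_right ?_ (hg x).le
  have h7 : C * (δ / (4 * (C + 1))) ≤ δ / 4 := by
    rw [mul_div_assoc', div_le_div_iff₀ (by positivity) (by norm_num)]
    nlinarith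
  nlinarith [mul_le_mul_of_nonneg_left hBsmall.le hC0]

/-! ### Integrated tails and their Riemann sums -/

/-- The integral of the tail of `μ` over `(x, ∞)`. -/
noncomputable def tailIntegral (μ : Measure ℝ) (x : ℝ) : ℝ :=
  (∫⁻ u in Ioi x, μ (Ioi u)).toReal

lemma tailIntegral_nonneg (μ : Measure ℝ) (x : ℝ) : 0 ≤ tailIntegral μ x :=
  ENNReal.toReal_nonneg

lemma lintegral_tail_ne_top {μ : Measure ℝ} [IsProbabilityMeasure μ] (hint : Integrable id μ)
    (hnn : ∀ᵐ y ∂μ, 0 ≤ y) (x : ℝ) : ∫⁻ u in Ioi x, μ (Ioi u) ≠ ⊤ := by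
  have h0 : ∫⁻ u in Ioi (0 : ℝ), μ (Ioi u) ≠ ⊤ := by
    have h1 := lintegral_eq_lintegral_meas_lt μ (f := id) hnn measurable_id.aemeasurable
    have h2 : ∫⁻ u in Ioi (0 : ℝ), μ (Ioi u) = ∫⁻ y, ENNReal.ofReal (id y) ∂μ := h1.symm
    rw [h2]
    exact hint.lintegral_lt_top.ne
  have hsub : Ioi x ⊆ Ioc x 0 ∪ Ioi 0 := fun y hy =>
    (le_or_gt y 0).imp (fun h => ⟨hy, h⟩) id
  refine ne_top_of_le_ne_top ?_ ((lintegral_mono_set hsub).trans (lintegral_union_le _ _ _))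
  refine ENNReal.add_ne_top.2 ⟨ne_top_of_le_ne_top ?_
    (lintegral_mono fun u => prob_le_one (μ := μ) (s := Ioi u)), h0⟩
  simp

lemma tailIntegral_sub_le {μ : Measure ℝ} [IsProbabilityMeasure μ] (hint : Integrable id μ)
    (hnn : ∀ᵐ y ∂μ, 0 ≤ y) (x : ℝ) {c : ℝ} (hc : 0 ≤ c) :
    c * μ.real (Ioi (x + c)) ≤ tailIntegral μ x - tailIntegral μ (x + c) ∧
      tailIntegral μ x - tailIntegral μ (x + c) ≤ c * μ.real (Ioi x) := by
  have hfin := lintegral_tail_ne_top hint hnn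
  have hsplit : ∫⁻ u in Ioi x, μ (Ioi u) =
      (∫⁻ u in Ioc x (x + c), μ (Ioi u)) + ∫⁻ u in Ioi (x + c), μ (Ioi u) := by
    rw [← lintegral_union measurableSet_Ioi (Ioc_disjoint_Ioi le_rfl),
      Ioc_union_Ioi_eq_Ioi (by linarith)]
  have hmid : ∫⁻ u in Ioc x (x + c), μ (Ioi u) ≠ ⊤ := by
    have := hfin x
    rw [hsplit] at this
    exact (ENNReal.add_ne_top.1 this).1
  have heq : tailIntegral μ x - tailIntegral μ (x + c) =
      (∫⁻ u in Ioc x (x + c), μ (Ioi u)).toReal := by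
    rw [tailIntegral, hsplit, ENNReal.toReal_add hmid (hfin _), tailIntegral]
    ring
  rw [heq]
  have hconst : ∀ y, ∫⁻ _ in Ioc x (x + c), μ (Ioi y) = ENNReal.ofReal c * μ (Ioi y) := by
    intro y
    rw [setLIntegral_const, Real.volume_Ioc, add_sub_cancel_left, mul_comm]
  have htr : ∀ y, c * μ.real (Ioi y) = (ENNReal.ofReal c * μ (Ioi y)).toReal := by
    intro y
    rw [ENNReal.toReal_mul, ENNReal.toReal_ofReal hc, measureReal_def]
  constructor
  · rw [htr, ← hconst]
    refine ENNReal.toReal_mono hmid (setLIntegral_mono' measurableSet_Ioc fun u hu => ?_)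
    exact measure_mono (Ioi_subset_Ioi hu.2)
  · rw [htr, ← hconst]
    refine ENNReal.toReal_mono ?_ (setLIntegral_mono' measurableSet_Ioc fun u hu => ?_)
    · rw [hconst]
      exact ENNReal.mul_ne_top ENNReal.ofReal_ne_top (measure_ne_top _ _)
    · exact measure_mono (Ioi_subset_Ioi hu.1.le)

lemma tailIntegral_anti {μ : Measure ℝ} [IsProbabilityMeasure μ] (hint : Integrable id μ)
    (hnn : ∀ᵐ y ∂μ, 0 ≤ y) : Antitone (tailIntegral μ) := fun x _ h =>
  ENNReal.toReal_mono (lintegral_tail_ne_top hint hnn x) (lintegral_mono_set (Ioi_subset_Ioi h))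

lemma tendsto_tailIntegral_atTop {μ : Measure ℝ} [IsProbabilityMeasure μ]
    (hint : Integrable id μ) (hnn : ∀ᵐ y ∂μ, 0 ≤ y) :
    Tendsto (tailIntegral μ) atTop (𝓝 0) := by
  let ν : Measure ℝ := (volume.restrict (Ioi 0)).withDensity fun u => μ (Ioi u)
  have : IsFiniteMeasure ν := isFiniteMeasure_withDensity (lintegral_tail_ne_top hint hnn 0)
  refine (tendsto_measureReal_Ioi_atTop ν).congr' ?_
  filter_upwards [eventually_ge_atTop 0] with x hx
  rw [measureReal_def, withDensity_apply _ measurableSet_Ioi,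
    Measure.restrict_restrict measurableSet_Ioi, inter_eq_left.2 (Ioi_subset_Ioi hx),
    tailIntegral]

/-- The truncation at 1 and the cut at 0 in `integratedTailCdf` are inactive far out, so
`tailIntegral` may replace the integrated tail law in all asymptotics. -/
lemma integratedTail_real_Ioi {μ : Measure ℝ} [IsProbabilityMeasure μ]
    (hint : Integrable id μ) (hnn : ∀ᵐ y ∂μ, 0 ≤ y) :
    ∀ᶠ x in atTop, (integratedTail μ).real (Ioi x) = tailIntegral μ x := by
  have hJ := tendsto_tailIntegral_atTop hint hnn
  have hev : ∀ᶠ x in atTop, 0 ≤ x ∧ tailIntegral μ x ≤ 1 :=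
    (eventually_ge_atTop 0).and
      ((hJ.eventually (gt_mem_nhds zero_lt_one)).mono fun _ h => h.le)
  have hval : ∀ᶠ x in atTop, integratedTailCdf μ x = 1 - tailIntegral μ x := by
    filter_upwards [hev] with x ⟨hx0, hx1⟩
    have h1 : ∫⁻ u in Ioi x, μ (Ioi u) ≤ 1 := by
      rw [← ENNReal.ofReal_toReal (lintegral_tail_ne_top hint hnn x)]
      exact ENNReal.ofReal_one ▸ ENNReal.ofReal_le_ofReal hx1
    change (if x < 0 then 0 else 1 - (min 1 (∫⁻ u in Ioi x, μ (Ioi u))).toReal) = _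
    rw [if_neg (not_lt.2 hx0), min_eq_right h1, tailIntegral]
  have hlim : Tendsto (integratedTailCdf μ) atTop (𝓝 1) := by
    have h1 := hJ.const_sub 1
    rw [sub_zero] at h1
    exact h1.congr' (hval.mono fun _ h => h.symm)
  filter_upwards [hval] with x hx
  rw [measureReal_def, integratedTail, StieltjesFunction.measure_Ioi _ hlim, hx,
    sub_sub_cancel, ENNReal.toReal_ofReal (tailIntegral_nonneg μ x)]

lemma mul_sum_tail_le {μ : Measure ℝ} [IsProbabilityMeasure μ]
    (hint : Integrable id μ) (hnn : ∀ᵐ y ∂μ, 0 ≤ y) (x : ℝ) {c : ℝ} (hc : 0 ≤ c) (k : ℕ) :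
    c * ∑ n ∈ Finset.range k, μ.real (Ioi (x + (n + 1 : ℕ) * c)) ≤
        tailIntegral μ x - tailIntegral μ (x + k * c) ∧
      tailIntegral μ x - tailIntegral μ (x + k * c) ≤
        c * ∑ n ∈ Finset.range k, μ.real (Ioi (x + n * c)) := by
  induction k with
  | zero => simp
  | succ k ih =>
    have h := tailIntegral_sub_le hint hnn (x + k * c) hc
    have h1 : x + k * c + c = x + ((k + 1 : ℕ) : ℝ) * c := by push_cast; ring
    rw [h1] at h
    rw [Finset.sum_range_succ, Finset.sum_range_succ, mul_add, mul_add]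
    constructor <;> linarith [ih.1, ih.2, h.1, h.2]

lemma sum_tail_le {μ : Measure ℝ} [IsProbabilityMeasure μ]
    (hint : Integrable id μ) (hnn : ∀ᵐ y ∂μ, 0 ≤ y) (x : ℝ) {c : ℝ} (hc : 0 < c) (k : ℕ) :
    ∑ n ∈ Finset.range k, μ.real (Ioi (x + n * c)) ≤ μ.real (Ioi x) + tailIntegral μ x / c := by
  have h1 := (mul_sum_tail_le hint hnn x hc.le k).1
  have h2 : ∑ n ∈ Finset.range k, μ.real (Ioi (x + (n + 1 : ℕ) * c)) ≤ tailIntegral μ x / c := by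
    rw [le_div_iff₀ hc]
    linarith [tailIntegral_nonneg μ (x + k * c)]
  have h3 : ∑ n ∈ Finset.range k, μ.real (Ioi (x + n * c)) ≤
      ∑ n ∈ Finset.range (k + 1), μ.real (Ioi (x + n * c)) :=
    Finset.sum_le_sum_of_subset_of_nonneg (Finset.range_mono (Nat.le_succ k))
      fun _ _ _ => measureReal_nonneg
  rw [Finset.sum_range_succ'] at h3
  simp only [Nat.cast_zero, zero_mul, add_zero] at h3
  linarith

lemma summable_tail {μ : Measure ℝ} [IsProbabilityMeasure μ]
    (hint : Integrable id μ) (hnn : ∀ᵐ y ∂μ, 0 ≤ y) (x : ℝ) {c : ℝ} (hc : 0 < c) :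
    Summable fun n : ℕ => μ.real (Ioi (x + n * c)) :=
  summable_of_sum_range_le (fun _ => measureReal_nonneg) (sum_tail_le hint hnn x hc)

lemma tsum_tail_le {μ : Measure ℝ} [IsProbabilityMeasure μ]
    (hint : Integrable id μ) (hnn : ∀ᵐ y ∂μ, 0 ≤ y) (x : ℝ) {c : ℝ} (hc : 0 < c) :
    ∑' n : ℕ, μ.real (Ioi (x + n * c)) ≤ μ.real (Ioi x) + tailIntegral μ x / c :=
  Real.tsum_le_of_sum_range_le (fun _ => measureReal_nonneg) (sum_tail_le hint hnn x hc)

lemma le_tsum_tail {μ : Measure ℝ} [IsProbabilityMeasure μ]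
    (hint : Integrable id μ) (hnn : ∀ᵐ y ∂μ, 0 ≤ y) (x : ℝ) {c : ℝ} (hc : 0 < c) :
    tailIntegral μ x / c ≤ ∑' n : ℕ, μ.real (Ioi (x + n * c)) := by
  rw [div_le_iff₀ hc, mul_comm]
  have h1 : Tendsto (fun k : ℕ => x + k * c) atTop atTop :=
    tendsto_atTop_add_const_left _ _ (tendsto_natCast_atTop_atTop.atTop_mul_const hc)
  have h2 := ((tendsto_tailIntegral_atTop hint hnn).comp h1).const_sub (tailIntegral μ x)
  rw [sub_zero] at h2
  exact le_of_tendsto_of_tendsto' h2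
    ((summable_tail hint hnn x hc).hasSum.tendsto_sum_nat.const_mul c)
    fun k => (mul_sum_tail_le hint hnn x hc.le k).2

/-- Moving the argument right by c changes J by at most c times the tail, which is o(J). Shifts to
the left follow by inverting the ratio. -/
lemma tendsto_tailIntegral_sub_div {μ : Measure ℝ} [IsProbabilityMeasure μ]
    (hint : Integrable id μ) (hnn : ∀ᵐ y ∂μ, 0 ≤ y) (hpos : ∀ x, 0 < tailIntegral μ x)
    (hsmall : Tendsto (fun x => μ.real (Ioi x) / tailIntegral μ x) atTop (𝓝 0)) (B : ℝ) :
    Tendsto (fun x => tailIntegral μ (x - B) / tailIntegral μ x) atTop (𝓝 1) := by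
  have hright : ∀ c ≥ 0,
      Tendsto (fun x => tailIntegral μ (x + c) / tailIntegral μ x) atTop (𝓝 1) := by
    intro c hc
    have h1 := (hsmall.const_mul c).const_sub 1
    rw [mul_zero, sub_zero] at h1
    refine tendsto_of_tendsto_of_tendsto_of_le_of_le h1 tendsto_const_nhds (fun x => ?_)
      fun x => ?_
    · have h2 := (tailIntegral_sub_le hint hnn x hc).2
      simp only
      rw [le_div_iff₀ (hpos x), sub_mul, mul_assoc, div_mul_cancel₀ _ (hpos x).ne']
      linarith
    · exact (div_le_one (hpos x)).2 (tailIntegral_anti hint hnn (by linarith))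
  rcases le_total B 0 with hB | hB
  · simpa [sub_eq_add_neg] using hright (-B) (by linarith)
  · have h1 := ((hright B hB).comp (tendsto_atTop_add_const_right atTop (-B) tendsto_id)).inv₀
      one_ne_zero
    rw [inv_one] at h1
    refine h1.congr fun x => ?_
    simp only [Function.comp, id, inv_div, neg_add_cancel_right, sub_eq_add_neg]

/-! ### Independent blocks and re-indexing of i.i.d. families -/

section Independence

variable {Ω ι : Type*} [MeasurableSpace Ω] {P : Measure Ω}

/-- Padding both blocks with zeros keeps them on the full index set, so functionals of the whole
family can be applied to either without restricting indices. -/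
lemma indepFun_indicator_of_disjoint {f : ι → Ω → ℝ} (hf : ∀ i, Measurable (f i))
    (h : iIndepFun f P) {S T : Set ι} (hST : Disjoint S T) :
    IndepFun (fun ω i => S.indicator (fun j => f j ω) i)
      (fun ω i => T.indicator (fun j => f j ω) i) P := by
  have hle : ∀ i, MeasurableSpace.comap (f i) inferInstance ≤ (inferInstance : MeasurableSpace Ω) :=
    fun i => (hf i).comap_le
  have hmeas : ∀ U : Set ι,
      Measurable[⨆ i ∈ U, MeasurableSpace.comap (f i) inferInstance]
        fun ω i => U.indicator (fun j => f j ω) i := by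
    intro U
    refine (@measurable_pi_iff Ω ι (fun _ => ℝ) (_) _ _).2 fun i => ?_
    by_cases hi : i ∈ U
    · simp only [indicator_of_mem hi]
      exact (comap_measurable (f i)).mono
        (le_iSup₂ (f := fun i (_ : i ∈ U) => MeasurableSpace.comap (f i) inferInstance) i hi) le_rfl
    · simp only [indicator_of_notMem hi]
      exact measurable_const
  have hind := indep_iSup_of_disjoint hle h hST
  exact indep_of_indep_of_le_left (indep_of_indep_of_le_right hind (hmeas T).comap_le)
    (hmeas S).comap_le

lemma map_precomp_eq_of_iid [IsProbabilityMeasure P] {f : ι → Ω → ℝ} (hf : ∀ i, Measurable (f i))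
    (h : iIndepFun f P) (hid : ∀ i j, IdentDistrib (f i) (f j) P P) {g : ι → ι}
    (hg : Function.Injective g) :
    P.map (fun ω i => f (g i) ω) = P.map fun ω i => f i ω := by
  rw [(h.precomp hg).map_fun_eq_infinitePi_map (fun i => hf (g i)),
    h.map_fun_eq_infinitePi_map hf]
  congr 1
  funext i
  exact (hid (g i) i).map_eq

end Independence

/-! ### First passage over a descending line and the maximum of a random walk -/

section Walk

variable {Ω : Type*} [MeasurableSpace Ω] {P : Measure Ω}

lemma measurable_sum_range_apply (n : ℕ) :
    Measurable fun u : ℕ → ℝ => ∑ i ∈ Finset.range n, u i :=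
  Finset.measurable_sum _ fun i _ => measurable_pi_apply i

/-- The sequences of increments whose walk first exceeds the line `A - n d` at time `j`. -/
def firstPassage (A d : ℝ) (j : ℕ) : Set (ℕ → ℝ) :=
  {u | A - j * d < ∑ i ∈ Finset.range j, u i ∧
    ∀ k < j, ∑ i ∈ Finset.range k, u i ≤ A - k * d}

lemma measurableSet_firstPassage (A d : ℝ) (j : ℕ) : MeasurableSet (firstPassage A d j) := by
  have h : firstPassage A d j = {u | A - j * d < ∑ i ∈ Finset.range j, u i} ∩
      ⋂ k, ⋂ (_ : k < j), {u | ∑ i ∈ Finset.range k, u i ≤ A - k * d} := by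
    ext u
    simp [firstPassage]
  rw [h]
  exact (measurableSet_lt measurable_const (measurable_sum_range_apply j)).inter
    (MeasurableSet.iInter fun k => MeasurableSet.iInter fun _ =>
      measurableSet_le (measurable_sum_range_apply k) measurable_const)

lemma pairwise_disjoint_firstPassage (A d : ℝ) :
    Pairwise (Function.onFun Disjoint (firstPassage A d)) := by
  have h : ∀ i j, i < j → Disjoint (firstPassage A d i) (firstPassage A d j) := by
    intro i j hij
    rw [Set.disjoint_left]
    intro u hi hj
    exact absurd (hj.2 i hij) (not_le.2 hi.1)
  intro i j hij
  rcases lt_or_gt_of_ne hij with h1 | h1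
  · exact h i j h1
  · exact (h j i h1).symm

lemma exists_mem_firstPassage {A d : ℝ} {u : ℕ → ℝ} {n : ℕ}
    (hn : A - n * d < ∑ i ∈ Finset.range n, u i) : ∃ j ≤ n, u ∈ firstPassage A d j := by
  classical
  have hex : ∃ n : ℕ, A - n * d < ∑ i ∈ Finset.range n, u i := ⟨n, hn⟩
  exact ⟨Nat.find hex, Nat.find_min' hex hn, Nat.find_spec hex,
    fun k hk => not_lt.1 (Nat.find_min hex hk)⟩

lemma measurableSet_exists_lt_sum (x : ℝ) :
    MeasurableSet {u : ℕ → ℝ | ∃ n, x < ∑ i ∈ Finset.range n, u i} := by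
  have h : {u : ℕ → ℝ | ∃ n, x < ∑ i ∈ Finset.range n, u i} =
      ⋃ n, {u | x < ∑ i ∈ Finset.range n, u i} := by
    ext u
    simp
  rw [h]
  exact MeasurableSet.iUnion fun n =>
    measurableSet_lt measurable_const (measurable_sum_range_apply n)

/-- The tail of the all-time maximum of a random walk whose increments have joint law `ρ`. -/
noncomputable def maxTail (ρ : Measure (ℕ → ℝ)) (x : ℝ) : ENNReal :=
  ρ {u | ∃ n, x < ∑ i ∈ Finset.range n, u i}

lemma maxTail_anti (ρ : Measure (ℕ → ℝ)) : Antitone (maxTail ρ) := fun _ _ h =>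
  measure_mono fun _ ⟨n, hn⟩ => ⟨n, h.trans_lt hn⟩

/-- The law of the position of a walk at its first passage above the line `A - n d`. -/
noncomputable def passageLaw (ρ : Measure (ℕ → ℝ)) (A d : ℝ) : Measure ℝ :=
  Measure.sum fun j => (ρ.restrict (firstPassage A d j)).map fun u => ∑ i ∈ Finset.range j, u i

lemma passageLaw_apply (ρ : Measure (ℕ → ℝ)) (A d : ℝ) {B : Set ℝ} (hB : MeasurableSet B) :
    passageLaw ρ A d B = ∑' j : ℕ,
      ρ ({u | ∑ i ∈ Finset.range j, u i ∈ B} ∩ firstPassage A d j) := by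
  rw [passageLaw, Measure.sum_apply _ hB]
  refine tsum_congr fun j => ?_
  rw [Measure.map_apply (measurable_sum_range_apply j) hB,
    Measure.restrict_apply (measurable_sum_range_apply j hB)]
  rfl

lemma passageLaw_univ (ρ : Measure (ℕ → ℝ)) (A d : ℝ) :
    passageLaw ρ A d univ = ρ {u | ∃ n : ℕ, A < (∑ i ∈ Finset.range n, u i) + n * d} := by
  rw [passageLaw_apply _ _ _ MeasurableSet.univ]
  simp only [mem_univ, ofPred_true, univ_inter]
  rw [← measure_iUnion (pairwise_disjoint_firstPassage A d) (measurableSet_firstPassage A d)]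
  congr 1
  ext u
  simp only [mem_iUnion, mem_ofPred_eq]
  constructor
  · rintro ⟨j, hj⟩
    exact ⟨j, by linarith [hj.1]⟩
  · rintro ⟨n, hn⟩
    obtain ⟨j, _, hj⟩ := exists_mem_firstPassage (A := A) (d := d) (u := u) (n := n)
      (by linarith)
    exact ⟨j, hj⟩

/-- If first passage occurs at time n + 1, the walk was at most A - nd one step earlier, so landing
above y requires an increment above y - A + nd. Time 0 contributes nothing because A ≥ 0. -/
lemma passageLaw_Ioi_le (ρ : Measure (ℕ → ℝ)) (μ : Measure ℝ) {A : ℝ} (hA : 0 ≤ A) (d : ℝ)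
    (hρ : ∀ (n : ℕ) (t : ℝ), ρ {u | t < u n} ≤ μ (Ioi t)) (y : ℝ) :
    passageLaw ρ A d (Ioi y) ≤ ∑' n : ℕ, μ (Ioi (y - A + n * d)) := by
  rw [passageLaw_apply _ _ _ measurableSet_Ioi, tsum_eq_zero_add' ENNReal.summable]
  have h0 : firstPassage A d 0 = ∅ := by
    ext u
    simp [firstPassage, hA]
  rw [h0, inter_empty, measure_empty, zero_add]
  refine ENNReal.tsum_le_tsum fun n => (measure_mono ?_).trans (hρ n _)
  rintro u ⟨h1, h2⟩
  have h3 := h2.2 n (Nat.lt_succ_self n)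
  simp only [mem_ofPred_eq, mem_Ioi, Finset.sum_range_succ] at h1 ⊢
  linarith

/-- Markov property at a fixed passage time: passage at j depends only on the first j increments,
and the later ones are independent of them with the law of the whole sequence. -/
lemma measure_firstPassage_inter [IsProbabilityMeasure P] {ξ : ℕ → Ω → ℝ}
    (hξ : ∀ n, Measurable (ξ n)) (hind : iIndepFun ξ P)
    (hid : ∀ i j, IdentDistrib (ξ i) (ξ j) P P) (A d x : ℝ) (j : ℕ) :
    P {ω | (fun n => ξ n ω) ∈ firstPassage A d j ∧
        ∃ i, x < ∑ k ∈ Finset.range j, ξ k ω + ∑ k ∈ Finset.range i, ξ (j + k) ω} =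
      ∫⁻ u in firstPassage A d j, maxTail (P.map fun ω n => ξ n ω) (x - ∑ k ∈ Finset.range j, u k)
        ∂(P.map fun ω n => ξ n ω) := by
  have hξm : Measurable fun ω n => ξ n ω := measurable_pi_iff.2 hξ
  set X : Ω → ℕ → ℝ := fun ω i => (Iio j).indicator (fun k => ξ k ω) i with hX
  set Y : Ω → ℕ → ℝ := fun ω i => ξ (j + i) ω with hY
  have hXm : Measurable X := measurable_pi_iff.2 fun i => by
    by_cases hi : i ∈ Iio j
    · simpa only [hX, indicator_of_mem hi] using hξ i
    · simp only [hX, indicator_of_notMem hi, measurable_const]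
  have hYm : Measurable Y := measurable_pi_iff.2 fun i => hξ _
  have hXY : IndepFun X Y P := by
    have h1 := (indepFun_indicator_of_disjoint hξ hind
      (Set.disjoint_left.2 fun i (h : i < j) h' => absurd h (not_lt.2 h') :
        Disjoint (Iio j) (Ici j))).comp measurable_id
      (measurable_pi_iff.2 fun i => measurable_pi_apply (j + i) :
        Measurable fun (u : ℕ → ℝ) i => u (j + i))
    convert h1 using 1
    · rfl
    · funext ω i
      exact (indicator_of_mem (show j + i ∈ Ici j from Nat.le_add_right j i)
        fun k => ξ k ω).symm
  have hlaw : P.map Y = P.map fun ω n => ξ n ω :=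
    map_precomp_eq_of_iid hξ hind hid (add_right_injective j)
  have hsum : ∀ ω, ∀ k ≤ j, ∑ i ∈ Finset.range k, X ω i = ∑ i ∈ Finset.range k, ξ i ω :=
    fun ω k hk => Finset.sum_congr rfl fun i hi =>
      indicator_of_mem (show i ∈ Iio j from (Finset.mem_range.1 hi).trans_le hk) _
  have hfp : ∀ ω, X ω ∈ firstPassage A d j ↔ (fun n => ξ n ω) ∈ firstPassage A d j := by
    intro ω
    simp only [firstPassage, mem_ofPred_eq, hsum ω j le_rfl]
    refine and_congr_right fun _ => forall₂_congr fun k hk => ?_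
    rw [hsum ω k hk.le]
  set E : Set ((ℕ → ℝ) × (ℕ → ℝ)) := {p | p.1 ∈ firstPassage A d j ∧
    ∃ i, x < ∑ k ∈ Finset.range j, p.1 k + ∑ k ∈ Finset.range i, p.2 k} with hE
  have hEm : MeasurableSet E := by
    have h : E = Prod.fst ⁻¹' firstPassage A d j ∩
        ⋃ i, {p : (ℕ → ℝ) × (ℕ → ℝ) | x < ∑ k ∈ Finset.range j, p.1 k + ∑ k ∈ Finset.range i, p.2 k} := by
      ext p
      simp [hE]
    rw [h]
    exact (measurable_fst (measurableSet_firstPassage A d j)).inter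
      (MeasurableSet.iUnion fun i => measurableSet_lt measurable_const
        (((measurable_sum_range_apply j).comp measurable_fst).add
          ((measurable_sum_range_apply i).comp measurable_snd)))
  have h1 : {ω | (fun n => ξ n ω) ∈ firstPassage A d j ∧
      ∃ i, x < ∑ k ∈ Finset.range j, ξ k ω + ∑ k ∈ Finset.range i, ξ (j + k) ω} =
      (fun ω => (X ω, Y ω)) ⁻¹' E := by
    ext ω
    simp only [hE, mem_preimage, mem_ofPred_eq, hfp, hsum ω j le_rfl, hY]
  rw [h1, ← Measure.map_apply (hXm.prodMk hYm) hEm,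
    (indepFun_iff_map_prod_eq_prod_map_map hXm.aemeasurable hYm.aemeasurable).1 hXY,
    Measure.prod_apply hEm, hlaw, lintegral_map (measurable_measure_prodMk_left hEm) hXm,
    ← lintegral_indicator (measurableSet_firstPassage A d j), lintegral_map _ hξm]
  · refine lintegral_congr fun ω => ?_
    by_cases hω : (fun n => ξ n ω) ∈ firstPassage A d j
    · rw [indicator_of_mem hω, maxTail]
      congr 1
      ext v
      simp only [hE, mem_preimage, mem_ofPred_eq, hfp, hω, true_and, hsum ω j le_rfl,
        sub_lt_iff_lt_add']
    · rw [indicator_of_notMem hω]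
      have : Prod.mk (X ω) ⁻¹' E = ∅ := by
        ext v
        simp [hE, hfp, hω]
      rw [this, measure_empty]
  · exact ((maxTail_anti _).measurable.comp
      (measurable_const.sub (measurable_sum_range_apply j))).indicator
        (measurableSet_firstPassage A d j)

/-- Since d ≥ 0 and A ≤ x, a walk above x is above the line at that time, so first passage has
already occurred; after it the walk starts afresh. -/
lemma maxTail_le_lintegral_passageLaw [IsProbabilityMeasure P] {ξ : ℕ → Ω → ℝ}
    (hξ : ∀ n, Measurable (ξ n)) (hind : iIndepFun ξ P)
    (hid : ∀ i j, IdentDistrib (ξ i) (ξ j) P P) {A d x : ℝ} (hd : 0 ≤ d) (hx : A ≤ x) :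
    maxTail (P.map fun ω n => ξ n ω) x ≤
      ∫⁻ y, maxTail (P.map fun ω n => ξ n ω) (x - y) ∂(passageLaw (P.map fun ω n => ξ n ω) A d) := by
  have hξm : Measurable fun ω n => ξ n ω := measurable_pi_iff.2 hξ
  have hmm : Measurable fun y => maxTail (P.map fun ω n => ξ n ω) (x - y) :=
    (maxTail_anti _).measurable.comp (measurable_const.sub measurable_id)
  rw [passageLaw, lintegral_sum_measure]
  have h1 : ∀ j : ℕ, ∫⁻ y, maxTail (P.map fun ω n => ξ n ω) (x - y)
      ∂(((P.map fun ω n => ξ n ω).restrict (firstPassage A d j)).map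
        fun u => ∑ i ∈ Finset.range j, u i) =
      P {ω | (fun n => ξ n ω) ∈ firstPassage A d j ∧
        ∃ i, x < ∑ k ∈ Finset.range j, ξ k ω + ∑ k ∈ Finset.range i, ξ (j + k) ω} := by
    intro j
    rw [lintegral_map hmm (measurable_sum_range_apply j),
      measure_firstPassage_inter hξ hind hid]
  simp only [h1]
  rw [maxTail, Measure.map_apply hξm (measurableSet_exists_lt_sum x)]
  refine (measure_mono ?_).trans (measure_iUnion_le _)
  rintro ω ⟨n, hn⟩
  have hnd : 0 ≤ (n : ℝ) * d := by positivity
  obtain ⟨j, hjn, hj⟩ := exists_mem_firstPassage (A := A) (d := d) (u := fun n => ξ n ω) (n := n)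
    (by linarith)
  refine mem_iUnion.2 ⟨j, hj, n - j, ?_⟩
  rw [← Finset.sum_range_add, Nat.add_sub_cancel' hjn]
  exact hn

/-- With d added to each increment the drift is still negative, so by the strong law the tilted walk
is almost surely bounded above; continuity from above concludes. -/
lemma tendsto_measure_exists_lt_sum_add [IsProbabilityMeasure P] {ξ : ℕ → Ω → ℝ}
    (hξ : ∀ n, Measurable (ξ n)) (hind : iIndepFun ξ P)
    (hid : ∀ i j, IdentDistrib (ξ i) (ξ j) P P) (hint : Integrable (ξ 0) P) {d : ℝ}
    (hd : d < -∫ ω, ξ 0 ω ∂P) :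
    Tendsto (fun A : ℝ => P.real {ω | ∃ n : ℕ, A < (∑ i ∈ Finset.range n, ξ i ω) + n * d})
      atTop (𝓝 0) := by
  have hlln := strong_law_ae_real ξ hint (fun i j hij => hind.indepFun hij) fun i => hid i 0
  have hnull : P (⋂ A : ℝ, {ω | ∃ n : ℕ, A < (∑ i ∈ Finset.range n, ξ i ω) + n * d}) = 0 := by
    have hae : ∀ᵐ ω ∂P, ∃ A : ℝ, ∀ n : ℕ, (∑ i ∈ Finset.range n, ξ i ω) + n * d ≤ A := by
      filter_upwards [hlln] with ω hω
      have h1 : IsBoundedUnder (· ≤ ·) atTop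
          fun n : ℕ => (∑ i ∈ Finset.range n, ξ i ω) + n * d := by
        refine ⟨0, ?_⟩
        rw [eventually_map]
        filter_upwards [hω.eventually (gt_mem_nhds (show _ < -d by linarith)),
          eventually_gt_atTop 0] with n hn hn0
        rw [div_lt_iff₀ (by exact_mod_cast hn0)] at hn
        linarith
      obtain ⟨A, hA⟩ := h1.bddAbove_range
      exact ⟨A, fun n => hA ⟨n, rfl⟩⟩
    refine measure_mono_null ?_ hae
    intro ω hω
    simp only [mem_iInter, mem_ofPred_eq] at hω
    simp only [mem_compl_iff, mem_ofPred_eq, not_exists, not_forall, not_le]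
    exact hω
  have h1 := tendsto_measure_iInter_atTop (μ := P)
    (s := fun A : ℝ => {ω | ∃ n : ℕ, A < (∑ i ∈ Finset.range n, ξ i ω) + n * d})
    (fun A => by
      have h : {ω | ∃ n : ℕ, A < (∑ i ∈ Finset.range n, ξ i ω) + n * d} =
          ⋃ n : ℕ, {ω | A < (∑ i ∈ Finset.range n, ξ i ω) + n * d} := by
        ext ω
        simp
      rw [h]
      exact (MeasurableSet.iUnion fun n => measurableSet_lt measurable_const
        ((Finset.measurable_sum _ fun i _ => hξ i).add_const _)).nullMeasurableSet)
    (fun A B hAB ω ⟨n, hn⟩ => ⟨n, lt_of_le_of_lt hAB hn⟩) ⟨0, measure_ne_top _ _⟩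
  rw [hnull] at h1
  exact (ENNReal.tendsto_toReal ENNReal.zero_ne_top).comp h1

/-- Upper half of Veraverbeke's theorem: the tail of the maximum of a random walk with drift
`-a < 0` is asymptotically at most `1 / a` times the integrated tail of the increments. -/
lemma eventually_measure_exists_lt_sum_le [IsProbabilityMeasure P] {ξ : ℕ → Ω → ℝ}
    (hξ : ∀ n, Measurable (ξ n)) (hind : iIndepFun ξ P)
    (hid : ∀ i j, IdentDistrib (ξ i) (ξ j) P P) (hint : Integrable (ξ 0) P)
    (hdrift : ∫ ω, ξ 0 ω ∂P < 0)
    {μ : Measure ℝ} [IsProbabilityMeasure μ] (hμint : Integrable id μ) (hnn : ∀ᵐ y ∂μ, 0 ≤ y)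
    (hξμ : ∀ n t, P {ω | t < ξ n ω} ≤ μ (Ioi t)) (hG : IsSubexponential (integratedTail μ))
    (hpos : ∀ x, 0 < tailIntegral μ x)
    (hsmall : Tendsto (fun x => μ.real (Ioi x) / tailIntegral μ x) atTop (𝓝 0))
    {θ : ℝ} (hθ : 1 / (-∫ ω, ξ 0 ω ∂P) < θ) :
    ∀ᶠ x in atTop, P.real {ω | ∃ n, x < ∑ i ∈ Finset.range n, ξ i ω} ≤ θ * tailIntegral μ x := by
  have hξm : Measurable fun ω n => ξ n ω := measurable_pi_iff.2 hξ
  set a := -∫ ω, ξ 0 ω ∂P with ha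
  have ha0 : 0 < a := by linarith
  have hθ0 : 0 < θ := lt_trans (by positivity) hθ
  -- Since dθ > 1, a passage probability γ below 1 - 1/(dθ) gives (1/d)/(1 - γ) < θ; since d < a, a
  -- large A achieves such a γ.
  obtain ⟨d, hd1, hd2⟩ := exists_between (show 1 / θ < a by
    rw [div_lt_iff₀ hθ0]; rw [div_lt_iff₀ ha0] at hθ; linarith)
  have hd0 : 0 < d := lt_trans (by positivity) hd1
  have hdθ : 1 / (d * θ) < 1 := by
    rw [div_lt_iff₀ (by positivity)]; rw [div_lt_iff₀ hθ0] at hd1; linarith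
  obtain ⟨A, hA, hA0⟩ := (((tendsto_measure_exists_lt_sum_add hξ hind hid hint hd2).eventually
    (gt_mem_nhds (show 0 < 1 - 1 / (d * θ) by linarith))).and (eventually_ge_atTop 0)).exists
  set ρ := P.map fun ω n => ξ n ω with hρ
  have hρprob : IsProbabilityMeasure ρ := Measure.isProbabilityMeasure_map hξm.aemeasurable
  have huniv : passageLaw ρ A d univ =
      P {ω | ∃ n : ℕ, A < (∑ i ∈ Finset.range n, ξ i ω) + n * d} := by
    rw [passageLaw_univ, hρ, Measure.map_apply hξm]
    · rfl
    · have h : {u : ℕ → ℝ | ∃ n : ℕ, A < (∑ i ∈ Finset.range n, u i) + n * d} =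
          ⋃ n : ℕ, {u | A < (∑ i ∈ Finset.range n, u i) + n * d} := by
        ext ω
        simp
      rw [h]
      exact MeasurableSet.iUnion fun n => measurableSet_lt measurable_const
        ((measurable_sum_range_apply n).add_const _)
  have hfin : IsFiniteMeasure (passageLaw ρ A d) := ⟨by
    rw [huniv]; exact measure_lt_top _ _⟩
  have hH1 : (passageLaw ρ A d).real univ < 1 - 1 / (d * θ) := by
    rw [measureReal_def, huniv]; exact hA
  have hGJ := integratedTail_real_Ioi hμint hnn
  have hback : ∀ (B : ℝ) {p : ℝ → Prop}, (∀ᶠ x in atTop, p x) → ∀ᶠ x in atTop, p (x - B) :=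
    fun B p hp => (tendsto_atTop_add_const_right atTop (-B) tendsto_id).eventually hp
  have hlong := tendsto_tailIntegral_sub_div hμint hnn hpos hsmall
  have hρμ : ∀ (n : ℕ) (t : ℝ), ρ {u | t < u n} ≤ μ (Ioi t) := fun n t => by
    rw [hρ, Measure.map_apply hξm (measurableSet_lt measurable_const (measurable_pi_apply n))]
    exact hξμ n t
  have hHle : ∀ x, (passageLaw ρ A d).real (Ioi x) ≤
      μ.real (Ioi (x - A)) + tailIntegral μ (x - A) / d := by
    intro x
    refine le_trans ?_ (tsum_tail_le hμint hnn (x - A) hd0)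
    rw [measureReal_def]
    refine ENNReal.toReal_le_of_le_ofReal (tsum_nonneg fun _ => measureReal_nonneg) ?_
    rw [ENNReal.ofReal_tsum_of_nonneg (fun _ => measureReal_nonneg)
      (summable_tail hμint hnn (x - A) hd0)]
    simp only [fun n : ℕ => ofReal_measureReal (μ := μ) (s := Ioi (x - A + n * d))]
    exact passageLaw_Ioi_le ρ μ hA0 d hρμ x
  have hratio : Tendsto (fun x => (μ.real (Ioi (x - A)) + tailIntegral μ (x - A) / d) /
      tailIntegral μ x) atTop (𝓝 (1 / d)) := by
    have h1 := ((hsmall.comp (tendsto_atTop_add_const_right atTop (-A) tendsto_id)).mul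
      (hlong A)).add ((hlong A).div_const d)
    rw [zero_mul, zero_add] at h1
    refine h1.congr fun x => ?_
    have h2 := (hpos x).ne'
    have h3 := (hpos (x - A)).ne'
    simp only [Function.comp, id, ← sub_eq_add_neg]
    field_simp
  have hmain := hG.eventually_tail_le (fun B => (hlong B).congr' (by
      filter_upwards [hGJ, hback B hGJ] with x h1 h2
      rw [h1, h2])) (passageLaw ρ A d) (c := 1 / d) (A := A) (by positivity)
    (hH1.trans (sub_lt_self 1 (by positivity))) (fun c' hc' => by
      filter_upwards [hratio.eventually (gt_mem_nhds hc'), hGJ] with x h1 h2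
      rw [div_lt_iff₀ (hpos x)] at h1
      rw [h2]
      exact (hHle x).trans h1.le) (maxTail_anti ρ) (fun x => prob_le_one)
    (fun x hx => maxTail_le_lintegral_passageLaw hξ hind hid hd0.le hx) θ (by
      rw [gt_iff_lt, div_div, div_lt_iff₀ (mul_pos hd0 (by
        linarith [show 0 < 1 / (d * θ) by positivity]))]
      have h1 : 1 / (d * θ) < 1 - (passageLaw ρ A d).real univ := by linarith
      rw [div_lt_iff₀ (by positivity)] at h1
      linarith)
  filter_upwards [hmain, hGJ] with x h1 h2
  rw [h2, maxTail, hρ, Measure.map_apply hξm (measurableSet_exists_lt_sum x)] at h1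
  exact h1

end Walk

/-! ### Bounds for unions of events -/

section Bonferroni

variable {Ω ι : Type*} [MeasurableSpace Ω] {P : Measure Ω} [IsProbabilityMeasure P]

/-- Bonferroni by induction: a new event overlaps the earlier union by at most q_k Σ q_i, which the
growth of the square of the sum absorbs. -/
lemma sum_sub_sq_le_measureReal_biUnion {E : ι → Set Ω} (hE : ∀ i, MeasurableSet (E i)) {q : ι → ℝ}
    (hq : ∀ i, 0 ≤ q i) (s : Finset ι)
    (h : ∀ i ∈ s, ∀ j ∈ s, i ≠ j → P.real (E i ∩ E j) ≤ q i * q j) :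
    ∑ i ∈ s, P.real (E i) - (∑ i ∈ s, q i) ^ 2 ≤ P.real (⋃ i ∈ s, E i) := by
  classical
  induction s using Finset.induction_on with
  | empty => simp
  | insert k s hk ih =>
    have ih' := ih fun i hi j hj hij =>
      h i (Finset.mem_insert_of_mem hi) j (Finset.mem_insert_of_mem hj) hij
    rw [Finset.sum_insert hk, Finset.sum_insert hk, Finset.set_biUnion_insert]
    have h1 := measureReal_union_add_inter' (μ := P) (t := ⋃ i ∈ s, E i) (hE k)
      (h₂ := measure_ne_top _ _)
    have h2 : P.real (E k ∩ ⋃ i ∈ s, E i) ≤ q k * ∑ i ∈ s, q i := by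
      rw [inter_iUnion₂, Finset.mul_sum]
      refine (measureReal_biUnion_finset_le s _).trans (Finset.sum_le_sum fun i hi => ?_)
      refine h k (Finset.mem_insert_self k s) i (Finset.mem_insert_of_mem hi) ?_
      rintro rfl
      exact hk hi
    nlinarith [hq k, Finset.sum_nonneg fun i (_ : i ∈ s) => hq i, sq_nonneg (q k)]

lemma measureReal_iUnion_le_tsum [Countable ι] {E : ι → Set Ω}
    (hs : Summable fun i => P.real (E i)) : P.real (⋃ i, E i) ≤ ∑' i, P.real (E i) := by
  refine ENNReal.toReal_le_of_le_ofReal (tsum_nonneg fun _ => measureReal_nonneg) ?_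
  rw [ENNReal.ofReal_tsum_of_nonneg (fun _ => measureReal_nonneg) hs]
  simp only [fun i => ofReal_measureReal (μ := P) (s := E i)]
  exact measure_iUnion_le E

end Bonferroni

/-! ### The waiting time as the maximum of a random walk -/

section Lindley

/-- Unrolling Lindley's recursion turns the waiting time into the maximum of the walk read backwards
from the customer; the empty sum accounts for the reflection at 0. -/
lemma lt_waitFrom_iff (s t : ℤ → ℝ) (m : ℤ) (k : ℕ) (y : ℝ) :
    y < waitFrom s t m k ↔ ∃ i ≤ k, y < ∑ j ∈ Finset.range i,
      (s (m + k - (j + 1 : ℕ)) - t (m + k - (j + 1 : ℕ))) := by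
  induction k generalizing y with
  | zero => simp [waitFrom]
  | succ k ih =>
    have hstep : ∀ i : ℕ, ∑ j ∈ Finset.range (i + 1),
        (s (m + (k + 1 : ℕ) - (j + 1 : ℕ)) - t (m + (k + 1 : ℕ) - (j + 1 : ℕ))) =
        (∑ j ∈ Finset.range i, (s (m + k - (j + 1 : ℕ)) - t (m + k - (j + 1 : ℕ)))) +
          (s (m + k) - t (m + k)) := by
      intro i
      rw [Finset.sum_range_succ']
      have h0 : m + (k + 1 : ℕ) - (0 + 1 : ℕ) = m + k := by push_cast; ring
      have h1 : ∀ j : ℕ, m + (k + 1 : ℕ) - (j + 1 + 1 : ℕ) = m + k - (j + 1 : ℕ) := by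
        intro j; push_cast; ring
      simp only [h0, h1]
    rw [waitFrom, lt_max_iff, show y < waitFrom s t m k + s (m + k) - t (m + k) ↔
      y - (s (m + k) - t (m + k)) < waitFrom s t m k by constructor <;> intro h <;> linarith, ih]
    constructor
    · rintro (h | ⟨i, hi, h⟩)
      · exact ⟨0, Nat.zero_le _, by simpa using h⟩
      · refine ⟨i + 1, Nat.succ_le_succ hi, ?_⟩
        rw [hstep]
        linarith
    · rintro ⟨i, hi, h⟩
      cases i with
      | zero => exact Or.inl (by simpa using h)
      | succ i =>
        refine Or.inr ⟨i, Nat.le_of_succ_le_succ hi, ?_⟩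
        rw [hstep] at h
        linarith

lemma lt_stationaryWait_iff (s t : ℤ → ℝ) (x : ℝ) :
    (x : EReal) < stationaryWait s t ↔ ∃ n : ℕ, x < ∑ j ∈ Finset.range n,
      (s (-(j + 1 : ℕ)) - t (-(j + 1 : ℕ))) := by
  simp only [stationaryWait, lt_iSup_iff, EReal.coe_lt_coe_iff, lt_waitFrom_iff, neg_add_cancel,
    zero_sub]
  exact ⟨fun ⟨_, i, _, h⟩ => ⟨i, h⟩, fun ⟨i, h⟩ => ⟨i, i, le_rfl, h⟩⟩

lemma lt_stationaryResponse_iff (s t : ℤ → ℝ) (x : ℝ) :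
    (x : EReal) < stationaryResponse s t ↔ ∃ n : ℕ, x < s 0 + ∑ j ∈ Finset.range n,
      (s (-(j + 1 : ℕ)) - t (-(j + 1 : ℕ))) := by
  have h : (x : EReal) < stationaryResponse s t ↔
      ((x - s 0 : ℝ) : EReal) < stationaryWait s t := by
    rw [stationaryResponse, EReal.coe_sub,
      EReal.sub_lt_iff (Or.inl (EReal.coe_ne_bot _)) (Or.inl (EReal.coe_ne_top _))]
  rw [h, lt_stationaryWait_iff]
  simp only [sub_lt_iff_lt_add']

end Lindley

/-! ### Independence and laws of the queue's increments -/

section Queue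

variable {Ω : Type*} [MeasurableSpace Ω] {P : Measure Ω}

lemma iIndepFun_bool_of_indepFun {β : Type*} [MeasurableSpace β] [IsProbabilityMeasure P]
    {X : Bool → Ω → β} (h : IndepFun (X true) (X false) P) : iIndepFun X P := by
  rw [iIndepFun_iff_measure_inter_preimage_eq_mul]
  intro S sets hS
  have hcases : S = ∅ ∨ S = {true} ∨ S = {false} ∨ S = {true, false} := by
    clear hS
    revert S
    decide
  rcases hcases with rfl | rfl | rfl | rfl
  · simp
  · simp
  · simp
  · rw [Finset.prod_pair (by decide)]
    rw [Finset.set_biInter_insert, Finset.set_biInter_singleton]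
    exact h.measure_inter_preimage_eq_mul _ _ (hS true (by simp)) (hS false (by simp))

/-- Service and interarrival times as a single family. -/
def queueFamily (σ τ : ℤ → Ω → ℝ) (p : ℤ × Bool) : Ω → ℝ :=
  if p.2 then σ p.1 else τ p.1

/-- The increment `σ_{-n} - τ_{-n}` of the random walk associated with the queue. -/
def queueIncrement (σ τ : ℤ → Ω → ℝ) (n : ℕ) (ω : Ω) : ℝ :=
  σ (-n) ω - τ (-n) ω

lemma measurable_queueFamily {σ τ : ℤ → Ω → ℝ} (hσ : ∀ n, Measurable (σ n))
    (hτ : ∀ n, Measurable (τ n)) (p : ℤ × Bool) : Measurable (queueFamily σ τ p) := by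
  unfold queueFamily
  split_ifs
  exacts [hσ _, hτ _]

lemma iIndepFun_queueFamily [IsProbabilityMeasure P] {σ τ : ℤ → Ω → ℝ}
    (hσ : ∀ n, Measurable (σ n)) (hτ : ∀ n, Measurable (τ n)) (hσi : iIndepFun σ P)
    (hτi : iIndepFun τ P) (hστ : IndepFun (fun ω n => σ n ω) (fun ω n => τ n ω) P) :
    iIndepFun (queueFamily σ τ) P := by
  have h := iIndepFun_uncurry' (P := P) (X := fun (b : Bool) (n : ℤ) => queueFamily σ τ (n, b))
    (fun b n => measurable_queueFamily hσ hτ (n, b))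
    (iIndepFun_bool_of_indepFun (by simpa [queueFamily] using hστ))
    (fun b => by cases b <;> simpa [queueFamily])
  exact iIndepFun.precomp (f := fun p : Bool × ℤ => queueFamily σ τ (p.2, p.1)) (g := Prod.swap)
    Prod.swap_injective h

/-- The joint law of all service and interarrival times is a product; currying it shows that the
pairs (σ_n, τ_n) are independent over n, and the increments are functions of these pairs. -/
lemma iIndepFun_queueIncrement [IsProbabilityMeasure P] {σ τ : ℤ → Ω → ℝ}
    (hσ : ∀ n, Measurable (σ n)) (hτ : ∀ n, Measurable (τ n)) (hσi : iIndepFun σ P)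
    (hτi : iIndepFun τ P) (hστ : IndepFun (fun ω n => σ n ω) (fun ω n => τ n ω) P) :
    iIndepFun (queueIncrement σ τ) P := by
  have hf := measurable_queueFamily hσ hτ
  have hi := iIndepFun_queueFamily hσ hτ hσi hτi hστ
  have hfm : Measurable fun ω p => queueFamily σ τ p ω := measurable_pi_iff.2 hf
  have hprob : ∀ p, IsProbabilityMeasure (P.map (queueFamily σ τ p)) :=
    fun p => Measure.isProbabilityMeasure_map (hf p).aemeasurable
  have hpair : iIndepFun (fun (n : ℤ) ω (b : Bool) => queueFamily σ τ (n, b) ω) P := by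
    rw [iIndepFun_iff_map_fun_eq_infinitePi_map fun n => measurable_pi_iff.2 fun b => hf (n, b)]
    have h1 : P.map (fun ω (n : ℤ) (b : Bool) => queueFamily σ τ (n, b) ω) =
        (P.map fun ω p => queueFamily σ τ p ω).map (MeasurableEquiv.curry ℤ Bool ℝ) := by
      rw [Measure.map_map (MeasurableEquiv.measurable _) hfm]
      rfl
    rw [h1, hi.map_fun_eq_infinitePi_map hf,
      Measure.infinitePi_map_curry fun n b => P.map (queueFamily σ τ (n, b))]
    congr 1
    funext n
    exact ((hi.precomp (Prod.mk_right_injective n)).map_fun_eq_infinitePi_map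
      fun b => hf (n, b)).symm
  have h2 := (hpair.precomp (g := fun n : ℕ => -(n : ℤ))
    fun m n h => by simpa using h).comp (fun _ u => u true - u false)
    fun _ => (measurable_pi_apply true).sub (measurable_pi_apply false)
  exact h2

lemma identDistrib_sub [IsProbabilityMeasure P] {X Y X' Y' : Ω → ℝ} (hX : Measurable X)
    (hY : Measurable Y) (hX' : Measurable X') (hY' : Measurable Y') (hXX' : IdentDistrib X X' P P)
    (hYY' : IdentDistrib Y Y' P P) (h : IndepFun X Y P) (h' : IndepFun X' Y' P) :
    IdentDistrib (fun ω => X ω - Y ω) (fun ω => X' ω - Y' ω) P P := by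
  have h1 : IdentDistrib (fun ω => (X ω, Y ω)) (fun ω => (X' ω, Y' ω)) P P := by
    refine ⟨(hX.prodMk hY).aemeasurable, (hX'.prodMk hY').aemeasurable, ?_⟩
    rw [(indepFun_iff_map_prod_eq_prod_map_map hX.aemeasurable hY.aemeasurable).1 h,
      (indepFun_iff_map_prod_eq_prod_map_map hX'.aemeasurable hY'.aemeasurable).1 h',
      hXX'.map_eq, hYY'.map_eq]
  exact h1.comp (measurable_fst.sub measurable_snd)

lemma identDistrib_queueIncrement [IsProbabilityMeasure P] {σ τ : ℤ → Ω → ℝ}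
    (hσ : ∀ n, Measurable (σ n)) (hτ : ∀ n, Measurable (τ n))
    (hσd : ∀ n, IdentDistrib (σ n) (σ 0) P P) (hτd : ∀ n, IdentDistrib (τ n) (τ 0) P P)
    (hστ : IndepFun (fun ω n => σ n ω) (fun ω n => τ n ω) P) (i j : ℕ) :
    IdentDistrib (queueIncrement σ τ i) (queueIncrement σ τ j) P P := by
  have h : ∀ n, IndepFun (σ n) (τ n) P := fun n =>
    hστ.comp (measurable_pi_apply n) (measurable_pi_apply n)
  exact identDistrib_sub (hσ _) (hτ _) (hσ _) (hτ _) ((hσd _).trans (hσd _).symm)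
    ((hτd _).trans (hτd _).symm) (h _) (h _)

/-- The response time does not have a heavier tail than the waiting time, because the waiting
time of the next customer is at least the response time minus an independent interarrival time. -/
lemma measure_response_mul_le [IsProbabilityMeasure P] {σ τ : ℤ → Ω → ℝ}
    (hσ : ∀ n, Measurable (σ n)) (hτ : ∀ n, Measurable (τ n)) (hσi : iIndepFun σ P)
    (hτi : iIndepFun τ P) (hστ : IndepFun (fun ω n => σ n ω) (fun ω n => τ n ω) P)
    (hσd : ∀ n, IdentDistrib (σ n) (σ 0) P P) (hτd : ∀ n, IdentDistrib (τ n) (τ 0) P P)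
    (x M : ℝ) :
    P.real {ω | ∃ n : ℕ, x < σ 0 ω + ∑ j ∈ Finset.range n, queueIncrement σ τ (j + 1) ω} *
        P.real {ω | τ 0 ω ≤ M} ≤
      P.real {ω | ∃ n : ℕ, x - M < ∑ j ∈ Finset.range n, queueIncrement σ τ (j + 1) ω} := by
  have hf := measurable_queueFamily hσ hτ
  have hind := indepFun_indicator_of_disjoint hf (iIndepFun_queueFamily hσ hτ hσi hτi hστ)
    (disjoint_compl_left : Disjoint ({((0 : ℤ), false)} : Set (ℤ × Bool))ᶜ {(0, false)})
  have hξ : ∀ n, Measurable (queueIncrement σ τ n) := fun n => (hσ _).sub (hτ _)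
  -- The walk started at index 0 is the one seen by customer 1; stationarity gives it the law of the
  -- walk started at index 1.
  have hlaw := map_precomp_eq_of_iid hξ (iIndepFun_queueIncrement hσ hτ hσi hτi hστ)
    (identDistrib_queueIncrement hσ hτ hσd hτd hστ) (add_left_injective 1)
  set U : Set (ℤ × Bool → ℝ) := {v | ∃ n : ℕ, x < v (0, true) + ∑ j ∈ Finset.range n,
    (v (-(j + 1 : ℕ), true) - v (-(j + 1 : ℕ), false))} with hU
  have hUm : MeasurableSet U := by
    have h : U = ⋃ n : ℕ, {v | x < v (0, true) + ∑ j ∈ Finset.range n,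
        (v (-(j + 1 : ℕ), true) - v (-(j + 1 : ℕ), false))} := by
      ext v
      simp [hU]
    rw [h]
    exact MeasurableSet.iUnion fun n => measurableSet_lt measurable_const (by fun_prop)
  have h1 := hind.measure_inter_preimage_eq_mul U {v | v (0, false) ≤ M} hUm
    (measurableSet_le (measurable_pi_apply _) measurable_const)
  have hne : ∀ (j : ℕ) (b : Bool), (-((j + 1 : ℕ) : ℤ), b) ∈ ({((0 : ℤ), false)} : Set (ℤ × Bool))ᶜ := by
    intro j b h
    have h2 := congrArg Prod.fst (mem_singleton_iff.1 h)
    simp only at h2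
    omega
  have hU' : (fun ω i => ({((0 : ℤ), false)} : Set (ℤ × Bool))ᶜ.indicator
      (fun j => queueFamily σ τ j ω) i) ⁻¹' U =
      {ω | ∃ n : ℕ, x < σ 0 ω + ∑ j ∈ Finset.range n, queueIncrement σ τ (j + 1) ω} := by
    ext ω
    simp only [hU, mem_preimage, mem_ofPred_eq, indicator_of_mem (hne _ _)]
    rw [indicator_of_mem (by simp)]
    rfl
  have hM' : (fun ω i => ({((0 : ℤ), false)} : Set (ℤ × Bool)).indicator
      (fun j => queueFamily σ τ j ω) i) ⁻¹' {v | v (0, false) ≤ M} = {ω | τ 0 ω ≤ M} := by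
    ext ω
    simp only [mem_preimage, mem_ofPred_eq]
    rw [indicator_of_mem (mem_singleton _)]
    rfl
  rw [hU', hM'] at h1
  have h3 : P {ω | ∃ n : ℕ, x - M < ∑ j ∈ Finset.range n, queueIncrement σ τ (j + 1) ω} =
      P {ω | ∃ n : ℕ, x - M < ∑ j ∈ Finset.range n, queueIncrement σ τ j ω} := by
    have h4 : P.map (fun ω i => queueIncrement σ τ (i + 1) ω)
        {u : ℕ → ℝ | ∃ n, x - M < ∑ i ∈ Finset.range n, u i} =
        P.map (fun ω i => queueIncrement σ τ i ω)
        {u : ℕ → ℝ | ∃ n, x - M < ∑ i ∈ Finset.range n, u i} := by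
      rw [← hlaw]
    rwa [Measure.map_apply (measurable_pi_iff.2 fun n => hξ _) (measurableSet_exists_lt_sum _),
      Measure.map_apply (measurable_pi_iff.2 hξ) (measurableSet_exists_lt_sum _)] at h4
  simp only [measureReal_def]
  rw [← ENNReal.toReal_mul, ← h1, h3]
  refine ENNReal.toReal_mono (measure_ne_top _ _) (measure_mono ?_)
  rintro ω ⟨⟨n, hn⟩, hM⟩
  -- One more term is needed: the increment σ_0 - τ_0 comes first, and τ_0 ≤ M.
  refine ⟨n + 1, ?_⟩
  rw [Finset.sum_range_succ']
  simp only [mem_ofPred_eq, queueIncrement, Nat.cast_zero, neg_zero] at hn hM ⊢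
  linarith

/-- The first function is the walk after k + 1 steps with its last service time removed, so it is
what the big jump σ_{-(k+1)} has to overcome. -/
lemma indepFun_sum_queueIncrement_sub [IsProbabilityMeasure P] {σ τ : ℤ → Ω → ℝ}
    (hσ : ∀ n, Measurable (σ n)) (hτ : ∀ n, Measurable (τ n)) (hσi : iIndepFun σ P)
    (hτi : iIndepFun τ P) (hστ : IndepFun (fun ω n => σ n ω) (fun ω n => τ n ω) P) (k : ℕ) :
    IndepFun (fun ω => ∑ j ∈ Finset.range k, queueIncrement σ τ (j + 1) ω - τ (-(k + 1 : ℕ)) ω)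
      (σ (-(k + 1 : ℕ))) P := by
  have hf := measurable_queueFamily hσ hτ
  have hind := indepFun_indicator_of_disjoint hf (iIndepFun_queueFamily hσ hτ hσi hτi hστ)
    (disjoint_compl_left : Disjoint ({(-((k + 1 : ℕ) : ℤ), true)} : Set (ℤ × Bool))ᶜ
      {(-((k + 1 : ℕ) : ℤ), true)})
  have hφ : Measurable fun v : ℤ × Bool → ℝ => ∑ j ∈ Finset.range k,
      (v (-(j + 1 : ℕ), true) - v (-(j + 1 : ℕ), false)) - v (-((k + 1 : ℕ) : ℤ), false) := by
    fun_prop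
  have hψ : Measurable fun v : ℤ × Bool → ℝ => v (-((k + 1 : ℕ) : ℤ), true) :=
    measurable_pi_apply _
  have h1 := hind.comp hφ hψ
  convert h1 using 1
  · funext ω
    simp only [Function.comp]
    congr 1
    · refine Finset.sum_congr rfl fun j hj => ?_
      have hjk := Finset.mem_range.1 hj
      rw [indicator_of_mem, indicator_of_mem]
      · rfl
      · simp
      · simp only [mem_compl_iff, mem_singleton_iff, Prod.mk.injEq, and_true]
        omega
    · rw [indicator_of_mem]
      · rfl
      · simp
  · funext ω
    simp only [Function.comp]
    rw [indicator_of_mem (mem_singleton _)]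
    rfl

/-- Law of large numbers for the walk without its last service time. The negated increments have
mean below c, and the single leftover interarrival time is o(k) in probability. -/
lemma tendsto_measure_sum_queueIncrement_lt [IsProbabilityMeasure P] {σ τ : ℤ → Ω → ℝ}
    (hσ : ∀ n, Measurable (σ n)) (hτ : ∀ n, Measurable (τ n)) (hσi : iIndepFun σ P)
    (hτi : iIndepFun τ P) (hστ : IndepFun (fun ω n => σ n ω) (fun ω n => τ n ω) P)
    (hσd : ∀ n, IdentDistrib (σ n) (σ 0) P P) (hτd : ∀ n, IdentDistrib (τ n) (τ 0) P P)
    (hσint : Integrable (σ 0) P) (hτint : Integrable (τ 0) P) {c : ℝ}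
    (hc : ∫ ω, τ 0 ω ∂P - ∫ ω, σ 0 ω ∂P < c) :
    Tendsto (fun k : ℕ => P.real {ω | ∑ j ∈ Finset.range k, queueIncrement σ τ (j + 1) ω -
      τ (-(k + 1 : ℕ)) ω < -((k + 1 : ℕ) * c)}) atTop (𝓝 0) := by
  have hξ : ∀ n, Measurable (queueIncrement σ τ n) := fun n => (hσ _).sub (hτ _)
  set X : ℕ → Ω → ℝ := fun n ω => -queueIncrement σ τ (n + 1) ω with hX
  set m := ∫ ω, τ 0 ω ∂P - ∫ ω, σ 0 ω ∂P with hm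
  have hXi : iIndepFun X P :=
    ((iIndepFun_queueIncrement hσ hτ hσi hτi hστ).precomp (add_left_injective 1)).comp
      (fun _ y => -y) fun _ => measurable_neg
  have hXd : ∀ i j, IdentDistrib (X i) (X j) P P := fun i j =>
    (identDistrib_queueIncrement hσ hτ hσd hτd hστ (i + 1) (j + 1)).comp measurable_neg
  have hσint1 : Integrable (σ (-((0 + 1 : ℕ) : ℤ))) P := (hσd _).integrable_iff.2 hσint
  have hτint1 : Integrable (τ (-((0 + 1 : ℕ) : ℤ))) P := (hτd _).integrable_iff.2 hτint
  have hXint : Integrable (X 0) P := (hσint1.sub hτint1).neg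
  have hmean : ∫ ω, X 0 ω ∂P = m := by
    simp only [hX, queueIncrement]
    rw [integral_neg, integral_sub hσint1 hτint1, (hσd _).integral_eq, (hτd _).integral_eq]
    ring
  set ε := (c - m) / 4 with hε
  have hε0 : 0 < ε := by rw [hε]; linarith
  have h1 := tendsto_measure_exists_lt_sum_add (ξ := X) (fun n => (hξ (n + 1)).neg) hXi hXd hXint
    (d := -(m + ε)) (by linarith)
  have hlin : Tendsto (fun k : ℕ => ((k + 1 : ℕ) : ℝ) * ε) atTop atTop :=
    (tendsto_natCast_atTop_atTop.comp (tendsto_add_atTop_nat 1)).atTop_mul_const hε0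
  have : IsProbabilityMeasure (P.map (τ 0)) := Measure.isProbabilityMeasure_map (hτ 0).aemeasurable
  have h2 := ((h1.comp hlin).add ((tendsto_measureReal_Ioi_atTop (P.map (τ 0))).comp hlin))
  rw [add_zero] at h2
  -- The sum has k terms but is compared with k + 1 times c. The difference m + ε may be negative
  -- here; the spare (k + 1) ε covers it.
  have hbase : ∀ᶠ k : ℕ in atTop, 0 ≤ m + ε + ((k + 1 : ℕ) : ℝ) * (2 * ε - ε) := by
    have h5 : Tendsto (fun k : ℕ => m + ε + ((k + 1 : ℕ) : ℝ) * ε) atTop atTop :=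
      tendsto_atTop_add_const_left _ _ hlin
    filter_upwards [h5.eventually_ge_atTop 0] with k hk
    linarith
  refine squeeze_zero' (Eventually.of_forall fun _ => measureReal_nonneg) ?_ h2
  filter_upwards [hbase] with k hk
  have h3 : (P.map (τ 0)).real (Ioi (((k + 1 : ℕ) : ℝ) * ε)) =
      P.real {ω | ((k + 1 : ℕ) : ℝ) * ε < τ (-(k + 1 : ℕ)) ω} := by
    rw [← (hτd (-(k + 1 : ℕ))).map_eq, measureReal_def, Measure.map_apply (hτ _) measurableSet_Ioi]
    rfl
  simp only [Function.comp]
  rw [h3]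
  refine le_trans (measureReal_mono ?_) (measureReal_union_le _ _)
  intro ω hω
  by_contra hcon
  simp only [mem_union, mem_ofPred_eq, not_or, not_exists, not_lt] at hcon
  have h4 := hcon.1 k
  simp only [hX, Finset.sum_neg_distrib, mem_ofPred_eq] at h4 hω
  have h6 := hcon.2
  have h7 : c = m + 4 * ε := by rw [hε]; ring
  rw [h7] at hω
  push_cast at *
  nlinarith

end Queue

/-! ### Comparison through a common normalisation -/

lemma tendsto_div_of_eventually_le {f J : ℝ → ℝ} {L : ℝ} (hJ : ∀ x, 0 < J x)
    (hlow : ∀ θ < L, ∀ᶠ x in atTop, θ * J x ≤ f x)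
    (hup : ∀ θ > L, ∀ᶠ x in atTop, f x ≤ θ * J x) :
    Tendsto (fun x => f x / J x) atTop (𝓝 L) := by
  refine tendsto_order.2 ⟨fun c hc => ?_, fun c hc => ?_⟩
  · obtain ⟨d, hd1, hd2⟩ := exists_between hc
    filter_upwards [hlow d hd2] with x hx
    exact hd1.trans_le ((le_div_iff₀ (hJ x)).2 hx)
  · obtain ⟨d, hd1, hd2⟩ := exists_between hc
    filter_upwards [hup d hd1] with x hx
    exact ((div_le_iff₀ (hJ x)).2 hx).trans_lt hd2

lemma tailEquiv_of_tendsto_div {f g J : ℝ → ℝ} {L : ℝ} (hL : L ≠ 0) (hJ : ∀ x, 0 < J x)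
    (hf : Tendsto (fun x => f x / J x) atTop (𝓝 L))
    (hg : Tendsto (fun x => g x / J x) atTop (𝓝 L)) : TailEquiv f g := by
  have h := hf.div hg hL
  rw [div_self hL] at h
  exact h.congr fun x => div_div_div_cancel_right₀ (hJ x).ne' _ _

/-! ### The single big jump and the main theorem -/

section Main

variable {Ω : Type*} [MeasurableSpace Ω] {P : Measure Ω} [IsProbabilityMeasure P]

/-- K and L are each independent of S, but K ∩ L need not be, so the failure of L is removed by a
union bound. -/
lemma mul_sub_le_measureReal_inter {K L S : Set Ω} (hK : P.real (K ∩ S) = P.real K * P.real S)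
    (hL : P.real (Lᶜ ∩ S) = P.real Lᶜ * P.real S) :
    P.real S * (P.real K - P.real Lᶜ) ≤ P.real (K ∩ L ∩ S) := by
  have h1 : K ∩ S ⊆ (K ∩ L ∩ S) ∪ (Lᶜ ∩ S) := by
    rintro ω ⟨h2, h3⟩
    by_cases h4 : ω ∈ L
    · exact Or.inl ⟨⟨h2, h4⟩, h3⟩
    · exact Or.inr ⟨h4, h3⟩
  have h2 := (measureReal_mono (μ := P) h1).trans (measureReal_union_le _ _)
  rw [hK, hL] at h2
  linarith

/-- Lower bound for the probability of a union of almost exclusive big-jump events. -/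
lemma eventually_le_measureReal_iUnion {μ : Measure ℝ} [IsProbabilityMeasure μ]
    (hμint : Integrable id μ) (hnn : ∀ᵐ y ∂μ, 0 ≤ y) (hpos : ∀ x, 0 < tailIntegral μ x)
    (hsmall : Tendsto (fun x => μ.real (Ioi x) / tailIntegral μ x) atTop (𝓝 0))
    {N : ℝ → ℕ} (hN : ∀ c : ℝ, Tendsto (fun x : ℝ =>
      (∑ n ∈ Finset.range (N x + 1), μ.real (Ioi (x + n * c))) / tailIntegral μ x) atTop (𝓝 0))
    {a : ℝ} (ha : 0 < a) {E : ℕ → ℝ → Set Ω} (hE : ∀ n x, MeasurableSet (E n x))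
    (hlow : ∀ ε > 0, ε < 1 → ∀ᶠ x in atTop, ∀ n ≥ N x,
      (1 - ε) * μ.real (Ioi (x + n * (a + ε))) ≤ P.real (E n x))
    (hup : ∀ ε > 0, ∀ᶠ x in atTop, ∀ i ≥ N x, ∀ j ≥ N x, i ≠ j →
      P.real (E i x ∩ E j x) ≤
        μ.real (Ioi (x + i * (a - ε))) * μ.real (Ioi (x + j * (a - ε))))
    {θ : ℝ} (hθ : θ < 1 / a) :
    ∀ᶠ x in atTop, θ * tailIntegral μ x ≤ P.real (⋃ n ∈ Ici (N x), E n x) := by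
  -- The lower bound obtained below is (1 - ε)/(a + ε) times J up to o(J), which tends to J/a as ε →
  -- 0.
  obtain ⟨ε, ⟨⟨hε1, hεa⟩, hεθ⟩, hε0⟩ : ∃ ε : ℝ, ((ε < 1 ∧ ε < a) ∧ θ < (1 - ε) * (1 / (a + ε))) ∧
      ε ∈ Ioi (0 : ℝ) := by
    have h1 : ContinuousAt (fun ε : ℝ => (1 - ε) * (1 / (a + ε))) 0 := by
      have : a + 0 ≠ 0 := by simpa using ha.ne'
      fun_prop (disch := assumption)
    have h2 : θ < (fun ε : ℝ => (1 - ε) * (1 / (a + ε))) 0 := by simpa using hθ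
    have h3 : ∀ᶠ ε in 𝓝[>] (0 : ℝ), ((ε < 1 ∧ ε < a) ∧ θ < (1 - ε) * (1 / (a + ε))) :=
      nhdsWithin_le_nhds (((gt_mem_nhds zero_lt_one).and (gt_mem_nhds ha)).and
        (h1.eventually (lt_mem_nhds h2)))
    exact (h3.and self_mem_nhdsWithin).exists
  rw [mem_Ioi] at hε0
  -- Main term over J: the full Riemann sum less its negligible initial part, minus the Bonferroni
  -- error, which is O(J) after division by J.
  have hlim := (((hN (a + ε)).const_sub (1 / (a + ε))).const_mul (1 - ε)).sub
    (((hsmall.add_const (1 / (a - ε))).pow 2).mul (tendsto_tailIntegral_atTop hμint hnn))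
  rw [mul_zero, sub_zero, sub_zero] at hlim
  filter_upwards [hlim.eventually (lt_mem_nhds hεθ), hlow ε hε0 hε1, hup ε hε0]
    with x hx hlx hux
  have hJ := hpos x
  set J := tailIntegral μ x with hJdef
  set Q := μ.real (Ioi x) + J / (a - ε) with hQ
  have hfin : ∀ k ≥ N x, (1 - ε) * (∑ n ∈ Finset.range k, μ.real (Ioi (x + n * (a + ε))) -
      ∑ n ∈ Finset.range (N x + 1), μ.real (Ioi (x + n * (a + ε)))) - Q ^ 2 ≤
      P.real (⋃ n ∈ Ici (N x), E n x) := by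
    intro k hk
    have h1 := sum_sub_sq_le_measureReal_biUnion (P := P) (fun n => hE n x)
      (q := fun n : ℕ => μ.real (Ioi (x + n * (a - ε)))) (fun _ => measureReal_nonneg)
      (Finset.Ico (N x) k) fun i hi j hj hij =>
        hux i (Finset.mem_Ico.1 hi).1 j (Finset.mem_Ico.1 hj).1 hij
    have h2 : P.real (⋃ n ∈ Finset.Ico (N x) k, E n x) ≤ P.real (⋃ n ∈ Ici (N x), E n x) :=
      measureReal_mono (iUnion₂_mono' fun n hn => ⟨n, (Finset.mem_Ico.1 hn).1, subset_rfl⟩)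
        (measure_ne_top _ _)
    have h3 : ∑ n ∈ Finset.Ico (N x) k, μ.real (Ioi (x + n * (a - ε))) ≤ Q :=
      (Finset.sum_le_sum_of_subset_of_nonneg
        (fun n hn => Finset.mem_range.2 (Finset.mem_Ico.1 hn).2)
        fun _ _ _ => measureReal_nonneg).trans (sum_tail_le hμint hnn x (by linarith) k)
    have h4 : 0 ≤ ∑ n ∈ Finset.Ico (N x) k, μ.real (Ioi (x + n * (a - ε))) :=
      Finset.sum_nonneg fun _ _ => measureReal_nonneg
    have h5 := pow_le_pow_left₀ h4 h3 2
    have h6 : (1 - ε) * ∑ n ∈ Finset.Ico (N x) k, μ.real (Ioi (x + n * (a + ε))) ≤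
        ∑ n ∈ Finset.Ico (N x) k, P.real (E n x) := by
      rw [Finset.mul_sum]
      exact Finset.sum_le_sum fun n hn => hlx n (Finset.mem_Ico.1 hn).1
    have h7 := Finset.sum_Ico_eq_sub (fun n : ℕ => μ.real (Ioi (x + n * (a + ε)))) hk
    have h8 : ∑ n ∈ Finset.range (N x), μ.real (Ioi (x + n * (a + ε))) ≤
        ∑ n ∈ Finset.range (N x + 1), μ.real (Ioi (x + n * (a + ε))) := by
      rw [Finset.sum_range_succ]
      exact le_add_of_nonneg_right measureReal_nonneg
    rw [h7] at h6
    have h9 := mul_le_mul_of_nonneg_left h8 (show 0 ≤ 1 - ε by linarith)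
    nlinarith
  have hae : 0 < a + ε := by linarith
  have hlimk := ((((summable_tail hμint hnn x hae).hasSum.tendsto_sum_nat.sub_const
    (∑ n ∈ Finset.range (N x + 1), μ.real (Ioi (x + n * (a + ε))))).const_mul (1 - ε)).sub_const
      (Q ^ 2))
  have hle := le_of_tendsto hlimk ((eventually_ge_atTop (N x)).mono hfin)
  have hts := mul_le_mul_of_nonneg_left (le_tsum_tail hμint hnn x hae)
    (show 0 ≤ 1 - ε by linarith)
  have hx' := mul_lt_mul_of_pos_right hx hJ
  have hid : ((1 - ε) * (1 / (a + ε) -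
      (∑ n ∈ Finset.range (N x + 1), μ.real (Ioi (x + n * (a + ε)))) / J) -
      (μ.real (Ioi x) / J + 1 / (a - ε)) ^ 2 * J) * J =
      (1 - ε) * (J / (a + ε)) -
        (1 - ε) * ∑ n ∈ Finset.range (N x + 1), μ.real (Ioi (x + n * (a + ε))) - Q ^ 2 := by
    have h1 : a - ε ≠ 0 := by linarith
    rw [hQ]
    field_simp
  rw [hid] at hx'
  linarith

end Main

theorem corollary5 {Ω : Type*} [MeasurableSpace Ω] (P : Measure Ω) [IsProbabilityMeasure P]
    (σ τ : ℤ → Ω → ℝ)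
    -- i.i.d. service times, i.i.d. interarrival times, the two sequences being independent
    (hσ_meas : ∀ n, Measurable (σ n)) (hτ_meas : ∀ n, Measurable (τ n))
    (hσ_nonneg : ∀ n, ∀ᵐ ω ∂P, 0 ≤ σ n ω) (hτ_nonneg : ∀ n, ∀ᵐ ω ∂P, 0 ≤ τ n ω)
    (hσ_indep : iIndepFun σ P) (hσ_ident : ∀ n, IdentDistrib (σ n) (σ 0) P P)
    (hτ_indep : iIndepFun τ P) (hτ_ident : ∀ n, IdentDistrib (τ n) (τ 0) P P)
    (hστ_indep : IndepFun (fun ω n => σ n ω) (fun ω n => τ n ω) P)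
    -- finite means `a > b`
    (hσ_int : Integrable (σ 0) P) (hτ_int : Integrable (τ 0) P)
    (a b : ℝ) (ha : a = ∫ ω, τ 0 ω ∂P) (hb : b = ∫ ω, σ 0 ω ∂P) (hab : b < a)
    -- the integrated tail distribution of the service times is subexponential
    (hFs : IsSubexponential (integratedTail (P.map (σ 0))))
    -- the associated function `N_x`
    (N : ℝ → ℕ) (hN_mono : Monotone N) (hN_top : Tendsto N atTop atTop)
    (hN : ∀ c : ℝ,
      (fun x : ℝ => ∑ n ∈ Finset.range (N x + 1), (P.map (σ 0)).real (Ioi (x + n * c)))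
        =o[atTop] fun x : ℝ => (integratedTail (P.map (σ 0))).real (Ioi x))
    -- the events `K_{n,x}`
    (K : ℕ → ℝ → Set Ω) (hK_meas : ∀ n x, MeasurableSet (K n x))
    (hK_indep : ∀ (n : ℕ) (x : ℝ) (B : Set ℝ), MeasurableSet B →
      P (K n x ∩ σ (-n) ⁻¹' B) = P (K n x) * P (σ (-n) ⁻¹' B))
    (hK_unif : ∀ ε : ℝ, 0 < ε → ∃ x₀ : ℝ, ∀ x ≥ x₀, ∀ n ≥ N x, |P.real (K n x) - 1| ≤ ε)
    (η : ℕ → ℝ) (hη : Tendsto η atTop (𝓝 0))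
    -- waiting time, response time, and the events `A_{n,x}` and `A_x`
    (W R : Ω → EReal)
    (hW : W = fun ω => stationaryWait (fun n => σ n ω) (fun n => τ n ω))
    (hR : R = fun ω => stationaryResponse (fun n => σ n ω) (fun n => τ n ω))
    (A : ℕ → ℝ → Set Ω) (hA : A = typicalEvent σ a b η K)
    (Ax : ℝ → Set Ω) (hAx : Ax = fun x => ⋃ n ∈ Ici (N x), A n x) :
    TailEquiv (fun x => P.real {ω | (x : EReal) < W ω})
        (fun x => P.real ({ω | (x : EReal) < W ω} ∩ Ax x)) ∧
      TailEquiv (fun x => P.real ({ω | (x : EReal) < W ω} ∩ Ax x)) (fun x => P.real (Ax x)) ∧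
      TailEquiv (fun x => P.real (Ax x))
        (fun x => ∑' n : Ici (N x), P.real ({ω | (x : EReal) < W ω} ∩ A n x)) ∧
      TailEquiv (fun x => ∑' n : Ici (N x), P.real ({ω | (x : EReal) < W ω} ∩ A n x))
        (fun x => ∑' n : Ici (N x), P.real (A n x)) ∧
      TailEquiv (fun x => P.real {ω | (x : EReal) < R ω})
        (fun x => P.real {ω | (x : EReal) < W ω}) := by
  set μ := P.map (σ 0) with hμ
  have hμprob : IsProbabilityMeasure μ :=
    Measure.isProbabilityMeasure_map (hσ_meas 0).aemeasurable
  have hτprob : IsProbabilityMeasure (P.map (τ 0)) :=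
    Measure.isProbabilityMeasure_map (hτ_meas 0).aemeasurable
  have hμint : Integrable id μ :=
    (integrable_map_measure measurable_id.aestronglyMeasurable (hσ_meas 0).aemeasurable).2 hσ_int
  have hnn : ∀ᵐ y ∂μ, 0 ≤ y :=
    (ae_map_iff (hσ_meas 0).aemeasurable measurableSet_Ici).2 (hσ_nonneg 0)
  have hσμ : ∀ (n : ℤ) (B : Set ℝ), MeasurableSet B → P (σ n ⁻¹' B) = μ B := fun n B hB => by
    rw [hμ, ← (hσ_ident n).map_eq, Measure.map_apply (hσ_meas n) hB]
  have hσμr : ∀ (n : ℤ) (y : ℝ), P.real {ω | y < σ n ω} = μ.real (Ioi y) := fun n y =>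
    congrArg ENNReal.toReal (hσμ n (Ioi y) measurableSet_Ioi)
  have hGJ := integratedTail_real_Ioi hμint hnn
  have hpos : ∀ x, 0 < tailIntegral μ x := by
    intro x
    obtain ⟨y, hy, hxy⟩ := (hGJ.and (eventually_ge_atTop x)).exists
    have := hFs.1
    have h1 : 0 < (integratedTail μ).real (Ioi y) := by
      rw [measureReal_def]
      exact ENNReal.toReal_pos (hFs.2.2.1 y).ne' (measure_ne_top _ _)
    rw [hy] at h1
    exact h1.trans_le (tailIntegral_anti hμint hnn hxy)
  have hN' : ∀ c : ℝ, Tendsto (fun x : ℝ =>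
      (∑ n ∈ Finset.range (N x + 1), μ.real (Ioi (x + n * c))) / tailIntegral μ x)
      atTop (𝓝 0) := fun c =>
    (hN c).tendsto_div_nhds_zero.congr' (hGJ.mono fun x hx => by simp only [hx])
  -- The condition on `N` already contains this: keep only the term n = 0.
  have hsmall : Tendsto (fun x => μ.real (Ioi x) / tailIntegral μ x) atTop (𝓝 0) := by
    refine squeeze_zero (fun x => div_nonneg measureReal_nonneg (hpos x).le) (fun x => ?_) (hN' 0)
    refine div_le_div_of_nonneg_right ?_ (hpos x).le
    have h1 := Finset.single_le_sum (f := fun n : ℕ => μ.real (Ioi (x + n * 0)))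
      (fun _ _ => measureReal_nonneg) (Finset.mem_range.2 (Nat.succ_pos (N x)))
    simpa using h1
  set m := a - b with hm
  have hm0 : 0 < m := by linarith
  have hL : (1 / m) ≠ 0 := by positivity
  have hξ : ∀ n, Measurable (queueIncrement σ τ n) := fun n => (hσ_meas _).sub (hτ_meas _)
  have hind := iIndepFun_queueIncrement hσ_meas hτ_meas hσ_indep hτ_indep hστ_indep
  have hid := identDistrib_queueIncrement hσ_meas hτ_meas hσ_ident hτ_ident hστ_indep
  have hWiff : ∀ x : ℝ, {ω | (x : EReal) < W ω} =
      {ω | ∃ n : ℕ, x < ∑ j ∈ Finset.range n, queueIncrement σ τ (j + 1) ω} := by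
    intro x
    ext ω
    rw [hW]
    exact lt_stationaryWait_iff _ _ x
  have hRiff : ∀ x : ℝ, {ω | (x : EReal) < R ω} =
      {ω | ∃ n : ℕ, x < σ 0 ω + ∑ j ∈ Finset.range n, queueIncrement σ τ (j + 1) ω} := by
    intro x
    ext ω
    rw [hR]
    exact lt_stationaryResponse_iff _ _ x
  have hWmeas : ∀ x : ℝ, MeasurableSet {ω | (x : EReal) < W ω} := fun x => by
    rw [hWiff]
    exact (measurable_pi_iff.2 fun n => hξ (n + 1)) (measurableSet_exists_lt_sum x)
  have hAmeas : ∀ n x, MeasurableSet (A n x) := fun n x => by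
    rw [hA]
    exact (hK_meas n x).inter (measurableSet_lt measurable_const (hσ_meas _))
  have hηN : ∀ ε > 0, ∀ᶠ x : ℝ in atTop, ∀ n ≥ N x, |η n| ≤ ε := by
    intro ε hε
    have h1 : ∀ᶠ n in atTop, |η n| ≤ ε := by
      have h2 := hη.abs
      rw [abs_zero] at h2
      exact (h2.eventually (gt_mem_nhds hε)).mono fun _ h => h.le
    obtain ⟨n₀, hn₀⟩ := eventually_atTop.1 h1
    filter_upwards [hN_top.eventually_ge_atTop n₀] with x hx n hn
    exact hn₀ n (hx.trans hn)
  have hAsub : ∀ ε > 0, ∀ᶠ x : ℝ in atTop, ∀ n ≥ N x,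
      A n x ⊆ {ω | x + n * (m - ε) < σ (-n) ω} := by
    intro ε hε
    filter_upwards [hηN ε hε] with x hx n hn ω hω
    rw [hA] at hω
    have h1 : x + n * (m + η n) < σ (-n) ω := hω.2
    refine lt_of_le_of_lt ?_ h1
    have h2 := (abs_le.1 (hx n hn)).1
    have h3 : (n : ℝ) * (m - ε) ≤ n * (m + η n) :=
      mul_le_mul_of_nonneg_left (by linarith) (Nat.cast_nonneg n)
    linarith
  have hdrift : ∫ ω, queueIncrement σ τ (0 + 1) ω ∂P = -m := by
    simp only [queueIncrement]
    rw [integral_sub ((hσ_ident _).integrable_iff.2 hσ_int)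
      ((hτ_ident _).integrable_iff.2 hτ_int), (hσ_ident _).integral_eq, (hτ_ident _).integral_eq,
      ← ha, ← hb, hm]
    ring
  have hWup : ∀ θ > 1 / m, ∀ᶠ x : ℝ in atTop,
      P.real {ω | (x : EReal) < W ω} ≤ θ * tailIntegral μ x := by
    intro θ hθ
    simp only [hWiff]
    refine eventually_measure_exists_lt_sum_le (ξ := fun n => queueIncrement σ τ (n + 1))
      (fun n => hξ (n + 1)) (hind.precomp (add_left_injective 1)) (fun i j => hid (i + 1) (j + 1))
      (((hσ_ident _).integrable_iff.2 hσ_int).sub ((hτ_ident _).integrable_iff.2 hτ_int))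
      (by rw [hdrift]; linarith) hμint hnn (fun n t => ?_) hFs hpos hsmall
      (by rw [hdrift, neg_neg]; exact hθ)
    rw [← hσμ (-(n + 1 : ℕ)) _ measurableSet_Ioi]
    refine measure_mono_ae ?_
    filter_upwards [hτ_nonneg (-(n + 1 : ℕ))] with ω h1 h2
    have h3 : t < σ (-(n + 1 : ℕ)) ω - τ (-(n + 1 : ℕ)) ω := h2
    exact lt_of_lt_of_le h3 (by linarith)
  have hApair : ∀ ε > 0, ∀ᶠ x : ℝ in atTop, ∀ i ≥ N x, ∀ j ≥ N x, i ≠ j →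
      P.real (({ω | (x : EReal) < W ω} ∩ A i x) ∩ ({ω | (x : EReal) < W ω} ∩ A j x)) ≤
        μ.real (Ioi (x + i * (m - ε))) * μ.real (Ioi (x + j * (m - ε))) := by
    intro ε hε
    filter_upwards [hAsub ε hε] with x hx i hi j hj hij
    have h1 : IndepFun (σ (-i)) (σ (-j)) P := hσ_indep.indepFun (by simpa using hij)
    have h2 := h1.measure_inter_preimage_eq_mul (Ioi (x + i * (m - ε))) (Ioi (x + j * (m - ε)))
      measurableSet_Ioi measurableSet_Ioi
    rw [hσμ _ _ measurableSet_Ioi, hσμ _ _ measurableSet_Ioi] at h2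
    rw [measureReal_def, measureReal_def, measureReal_def, ← ENNReal.toReal_mul, ← h2]
    exact ENNReal.toReal_mono (measure_ne_top _ _)
      (measure_mono fun ω hω => ⟨hx i hi hω.1.2, hx j hj hω.2.2⟩)
  -- The big jump: if K_{n,x} holds, the rest of the walk is at least -n(m + ε) and σ_{-n} > x + n(m
  -- + ε), then both W > x and A_{n,x} occur. The first two conditions each fail with probability at
  -- most ε/2.
  have hAlow : ∀ ε > 0, ε < 1 → ∀ᶠ x : ℝ in atTop, ∀ n ≥ N x,
      (1 - ε) * μ.real (Ioi (x + n * (m + ε))) ≤ P.real ({ω | (x : EReal) < W ω} ∩ A n x) := by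
    intro ε hε _
    obtain ⟨x₀, hx₀⟩ := hK_unif (ε / 2) (by linarith)
    have hlln := tendsto_measure_sum_queueIncrement_lt hσ_meas hτ_meas hσ_indep hτ_indep hστ_indep
      hσ_ident hτ_ident hσ_int hτ_int (c := m + ε) (by rw [← ha, ← hb]; linarith)
    obtain ⟨k₀, hk₀⟩ := eventually_atTop.1
      (hlln.eventually (gt_mem_nhds (show 0 < ε / 2 by linarith)))
    filter_upwards [hηN ε hε, hN_top.eventually_ge_atTop (k₀ + 1), eventually_ge_atTop x₀]
      with x hηx hNx hx n hn
    obtain ⟨k, rfl⟩ : ∃ k, n = k + 1 := Nat.exists_eq_succ_of_ne_zero (by omega)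
    set L := {ω | ∑ j ∈ Finset.range k, queueIncrement σ τ (j + 1) ω -
      τ (-(k + 1 : ℕ)) ω < -((k + 1 : ℕ) * (m + ε))}ᶜ with hLdef
    set y := x + (k + 1 : ℕ) * (m + ε) with hy
    have h1 : P.real (K (k + 1) x ∩ {ω | y < σ (-(k + 1 : ℕ)) ω}) =
        P.real (K (k + 1) x) * P.real {ω | y < σ (-(k + 1 : ℕ)) ω} := by
      simp only [measureReal_def]
      rw [← ENNReal.toReal_mul]
      exact congrArg ENNReal.toReal (hK_indep (k + 1) x (Ioi y) measurableSet_Ioi)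
    have h2 : P.real (Lᶜ ∩ {ω | y < σ (-(k + 1 : ℕ)) ω}) =
        P.real Lᶜ * P.real {ω | y < σ (-(k + 1 : ℕ)) ω} := by
      simp only [measureReal_def]
      rw [← ENNReal.toReal_mul, hLdef, compl_compl]
      exact congrArg ENNReal.toReal ((indepFun_sum_queueIncrement_sub hσ_meas hτ_meas hσ_indep
        hτ_indep hστ_indep k).measure_inter_preimage_eq_mul (Iio _) (Ioi y) measurableSet_Iio
          measurableSet_Ioi)
    have h3 := mul_sub_le_measureReal_inter h1 h2
    have h4 : P.real Lᶜ ≤ ε / 2 := by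
      rw [hLdef, compl_compl]
      exact (hk₀ k (by omega)).le
    have h5 := (abs_le.1 (hx₀ x hx (k + 1) hn)).1
    rw [hσμr] at h3
    have h6 : (1 - ε) * μ.real (Ioi y) ≤
        μ.real (Ioi y) * (P.real (K (k + 1) x) - P.real Lᶜ) := by
      rw [mul_comm]
      exact mul_le_mul_of_nonneg_left (by linarith) measureReal_nonneg
    refine (h6.trans h3).trans (measureReal_mono ?_)
    rintro ω ⟨⟨hωK, hωL⟩, hωS⟩
    simp only [hLdef, mem_compl_iff, mem_ofPred_eq, not_lt] at hωL hωS
    refine ⟨?_, ?_⟩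
    · rw [hWiff]
      refine ⟨k + 1, ?_⟩
      rw [Finset.sum_range_succ]
      change x < _ + (σ (-(k + 1 : ℕ)) ω - τ (-(k + 1 : ℕ)) ω)
      linarith
    · rw [hA]
      refine ⟨hωK, ?_⟩
      change x + (k + 1 : ℕ) * (m + η (k + 1)) < σ (-(k + 1 : ℕ)) ω
      refine lt_of_le_of_lt ?_ hωS
      have h7 := (abs_le.1 (hηx (k + 1) hn)).2
      have h8 : ((k + 1 : ℕ) : ℝ) * (m + η (k + 1)) ≤ (k + 1 : ℕ) * (m + ε) :=
        mul_le_mul_of_nonneg_left (by linarith) (Nat.cast_nonneg _)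
      linarith
  have hWA : ∀ x : ℝ, {ω | (x : EReal) < W ω} ∩ Ax x =
      ⋃ n ∈ Ici (N x), {ω | (x : EReal) < W ω} ∩ A n x := fun x => by
    rw [hAx, inter_iUnion₂]
  have hlow : ∀ θ < 1 / m, ∀ᶠ x : ℝ in atTop,
      θ * tailIntegral μ x ≤ P.real ({ω | (x : EReal) < W ω} ∩ Ax x) := by
    intro θ hθ
    simp only [hWA]
    exact eventually_le_measureReal_iUnion hμint hnn hpos hsmall hN' hm0
      (E := fun n x => {ω | (x : EReal) < W ω} ∩ A n x)
      (fun n x => (hWmeas x).inter (hAmeas n x)) hAlow hApair hθ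
  have hAle : ∀ ε > 0, ∀ᶠ x : ℝ in atTop, ∀ n : Ici (N x),
      P.real (A n x) ≤ μ.real (Ioi (x + (n : ℕ) * (m - ε))) := by
    intro ε hε
    filter_upwards [hAsub ε hε] with x hx n
    exact (measureReal_mono (hx n n.2)).trans (hσμr _ _).le
  have hsumA : ∀ᶠ x : ℝ in atTop, Summable fun n : Ici (N x) => P.real (A n x) := by
    filter_upwards [hAle (m / 2) (by linarith)] with x hx
    exact Summable.of_nonneg_of_le (fun _ => measureReal_nonneg) hx
      ((summable_tail hμint hnn x (by linarith)).subtype _)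
  have hsumWA : ∀ᶠ x : ℝ in atTop,
      Summable fun n : Ici (N x) => P.real ({ω | (x : EReal) < W ω} ∩ A n x) :=
    hsumA.mono fun x hx => Summable.of_nonneg_of_le (fun _ => measureReal_nonneg)
      (fun n => measureReal_mono inter_subset_right) hx
  have hSup : ∀ θ > 1 / m, ∀ᶠ x : ℝ in atTop,
      ∑' n : Ici (N x), P.real (A n x) ≤ θ * tailIntegral μ x := by
    intro θ hθ
    have hθ0 : 0 < θ := lt_trans (by positivity) hθ
    -- With ε = m - d the slope m - ε becomes d, and 1/d < θ.
    obtain ⟨d, hd1, hd2⟩ := exists_between (show 1 / θ < m by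
      rw [div_lt_iff₀ hθ0]; rw [gt_iff_lt, div_lt_iff₀ hm0] at hθ; linarith)
    have hd0 : 0 < d := lt_trans (by positivity) hd1
    have h1 : 1 / d < θ := by
      rw [div_lt_iff₀ hd0]; rw [div_lt_iff₀ hθ0] at hd1; linarith
    have h2 := hsmall.add_const (1 / d)
    rw [zero_add] at h2
    filter_upwards [hAle (m - d) (by linarith), hsumA, h2.eventually (gt_mem_nhds h1)]
      with x hx hs hlt
    simp only [sub_sub_cancel] at hx
    have h3 := summable_tail hμint hnn x hd0
    have h4 := (hs.tsum_le_tsum hx (h3.subtype _)).trans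
      (h3.tsum_subtype_le (fun n : ℕ => μ.real (Ioi (x + n * d))) (Ici (N x))
        (fun _ => measureReal_nonneg))
    refine (h4.trans (tsum_tail_le hμint hnn x hd0)).trans ?_
    have h5 := mul_le_mul_of_nonneg_right hlt.le (hpos x).le
    have h6 : (μ.real (Ioi x) / tailIntegral μ x + 1 / d) * tailIntegral μ x =
        μ.real (Ioi x) + tailIntegral μ x / d := by
      have := (hpos x).ne'
      field_simp
    linarith
  -- Every quantity dominates P(W > x, A_x), so `hlow` serves as the lower bound throughout; `hWup`
  -- or `hSup` bounds those other than the response tail from above.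
  have hW_lim := tendsto_div_of_eventually_le hpos (fun θ hθ => (hlow θ hθ).mono fun x hx =>
    hx.trans (measureReal_mono inter_subset_left)) hWup
  have hWA_lim := tendsto_div_of_eventually_le hpos hlow fun θ hθ => (hWup θ hθ).mono fun x hx =>
    (measureReal_mono inter_subset_left).trans hx
  have hA_lim := tendsto_div_of_eventually_le (f := fun x => P.real (Ax x)) hpos
    (fun θ hθ => (hlow θ hθ).mono fun x hx => hx.trans (measureReal_mono inter_subset_right))
    fun θ hθ => by
      filter_upwards [hSup θ hθ, hsumA] with x hx hs
      refine le_trans ?_ hx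
      rw [hAx]
      simp only [biUnion_eq_iUnion]
      exact measureReal_iUnion_le_tsum hs
  have hSWA_lim := tendsto_div_of_eventually_le
    (f := fun x => ∑' n : Ici (N x), P.real ({ω | (x : EReal) < W ω} ∩ A n x)) hpos
    (fun θ hθ => by
      filter_upwards [hlow θ hθ, hsumWA] with x hx hs
      refine hx.trans ?_
      rw [hWA]
      simp only [biUnion_eq_iUnion]
      exact measureReal_iUnion_le_tsum hs)
    fun θ hθ => by
      filter_upwards [hSup θ hθ, hsumA, hsumWA] with x hx hs hs'
      exact (hs'.tsum_le_tsum (fun n => measureReal_mono inter_subset_right) hs).trans hx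
  have hSA_lim := tendsto_div_of_eventually_le
    (f := fun x => ∑' n : Ici (N x), P.real (A n x)) hpos
    (fun θ hθ => by
      filter_upwards [hlow θ hθ, hsumA] with x hx hs
      refine hx.trans ((measureReal_mono inter_subset_right).trans ?_)
      rw [hAx]
      simp only [biUnion_eq_iUnion]
      exact measureReal_iUnion_le_tsum hs) hSup
  have hR_lim := tendsto_div_of_eventually_le (f := fun x : ℝ => P.real {ω | (x : EReal) < R ω})
    hpos (L := 1 / m)
    (fun θ hθ => by
      filter_upwards [hlow θ hθ] with x hx
      refine hx.trans ((measureReal_mono inter_subset_left).trans ?_)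
      refine ENNReal.toReal_mono (measure_ne_top _ _) (measure_mono_ae ?_)
      filter_upwards [hσ_nonneg 0] with ω h1 h2
      have h3 : ω ∈ {ω | (x : EReal) < W ω} := h2
      rw [hWiff] at h3
      obtain ⟨n, hn⟩ := h3
      change ω ∈ {ω | (x : EReal) < R ω}
      rw [hRiff]
      exact ⟨n, by linarith⟩)
    fun θ hθ => by
      have hθ0 : 0 < θ := lt_trans (by positivity) hθ
      obtain ⟨θ', h1, h2⟩ := exists_between hθ
      have h3 := (tendsto_measureReal_Ioi_atTop (P.map (τ 0))).const_sub 1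
      rw [sub_zero] at h3
      -- For P(τ_0 ≤ M) > θ'/θ, dividing the bound P(W > x - M) ≤ θ' J(x) by this probability costs
      -- at most the factor θ/θ'.
      obtain ⟨M, hM⟩ := (h3.eventually
        (lt_mem_nhds (show θ' / θ < 1 by rwa [div_lt_one hθ0]))).exists
      have h4 : P.real {ω | τ 0 ω ≤ M} = 1 - (P.map (τ 0)).real (Ioi M) := by
        rw [← probReal_compl_eq_one_sub measurableSet_Ioi, compl_Ioi, measureReal_def,
          measureReal_def, Measure.map_apply (hτ_meas 0) measurableSet_Iic]
        rfl
      rw [← h4, div_lt_iff₀ hθ0] at hM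
      have h5 := (hW_lim.comp (tendsto_atTop_add_const_right atTop (-M) tendsto_id)).mul
        (tendsto_tailIntegral_sub_div hμint hnn hpos hsmall M)
      rw [mul_one] at h5
      have h6 : 0 < P.real {ω | τ 0 ω ≤ M} := by
        have h7 : 0 < θ' := lt_trans (by positivity) h1
        by_contra! hcon
        nlinarith
      filter_upwards [h5.eventually (gt_mem_nhds h1)] with x hx
      simp only [Function.comp, id, ← sub_eq_add_neg] at hx
      rw [div_mul_div_cancel₀ (hpos _).ne', div_lt_iff₀ (hpos x)] at hx
      have h8 := measure_response_mul_le hσ_meas hτ_meas hσ_indep hτ_indep hστ_indep hσ_ident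
        hτ_ident x M
      rw [← hRiff, ← hWiff] at h8
      have h9 := mul_lt_mul_of_pos_right hM (hpos x)
      refine le_of_mul_le_mul_right ?_ h6
      linarith
  exact ⟨tailEquiv_of_tendsto_div hL hpos hW_lim hWA_lim,
    tailEquiv_of_tendsto_div hL hpos hWA_lim hA_lim,
    tailEquiv_of_tendsto_div hL hpos hA_lim hSWA_lim,
    tailEquiv_of_tendsto_div hL hpos hSWA_lim hSA_lim,
    tailEquiv_of_tendsto_div hL hpos hR_lim hW_lim⟩
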